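/- Let $D\ge 2$ be an integer. Let $\mathcal P^D$ be the class of nonempty open, bounded, convex sets $\Omega\subset\mathbb R^D$ and, for $r>0$, let $\mathcal P^D(r)$ be the subclass of those whose inradius $R_\Omega$ (supremum of the radii of balls contained in $\Omega$) equals $r$. For $p\in(1,\infty)$ and $\Omega\in\mathcal P^D$ let $u_p\in W^{1,p}_0(\Omega)$ be the weak solution of $-\operatorname{div}(|\nabla u|^{p-2}\nabla u)=1$ in $\Omega$, $u=0$ on $\partial\Omega$; put $$T_p(\Omega)=\int_\Omega u_p\,dx,\qquad T(p;\Omega)=|\Omega|^{p-1}\,T_p(\Omega)^{1-p},\qquad Q_p(\Omega)=\left(\frac{T(p;\Omega)\,R_\Omega^p}{\left(\frac{2p-1}{p-1}\right)^{p-1}}\right)^{1/p},$$ $$\gamma_{D,p}=\frac{\inf_{\Omega\in\mathcal P^D}Q_p(\Omega)}{\sup_{\Omega\in\mathcal P^D}Q_p(\Omega)},\qquad \gamma_D=\inf_{p\in(1,\infty)}\gamma_{D,p}.$$ Then $\gamma_D\in[1/D,1)$, and for all real numbers $0<a<b$ the following hold. 1. If $\gamma_D b<a$, then there exist $p\in(1,\infty)$,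 $\Omega_a\in\mathcal P^D(a)$ and $\Omega_b\in\mathcal P^D(b)$ such that $T(p;\Omega_a)<T(p;\Omega_b)$. 2. If $\gamma_D b\ge a$, then $T(p;\Omega_b)\le T(p;\Omega_a)$ for all $\Omega_a\in\mathcal P^D(a)$, all $\Omega_b\in\mathcal P^D(b)$ and all $p\in(1,\infty)$. 3. If $\gamma_D b>a$, then $T(p;\Omega_b)<T(p;\Omega_a)$ for all $\Omega_a\in\mathcal P^D(a)$, all $\Omega_b\in\mathcal P^D(b)$ and all $p\in(1,\infty)$. -/

import Mathlib

open MeasureTheory Filter Topology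
open scoped ContDiff

noncomputable section

namespace PTorsion

/-- The Euclidean space `ℝ^D`. -/
abbrev E (D : ℕ) : Type := EuclideanSpace ℝ (Fin D)

/-- Nonempty open bounded convex subsets of `ℝ^D`. -/
def convexDomains (D : ℕ) : Set (Set (E D)) :=
  {Ω | IsOpen Ω ∧ Bornology.IsBounded Ω ∧ Convex ℝ Ω ∧ Ω.Nonempty}

/-- The inradius: the supremum of the radii of the balls contained in `Ω`. -/
def inradius {D : ℕ} (Ω : Set (E D)) : ℝ :=
  sSup {r : ℝ | 0 < r ∧ ∃ x, Metric.ball x r ⊆ Ω}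

/-- Nonempty open bounded convex subsets of `ℝ^D` with inradius `r`. -/
def convexDomainsOfInradius (D : ℕ) (r : ℝ) : Set (Set (E D)) :=
  {Ω | Ω ∈ convexDomains D ∧ inradius Ω = r}

/-- Test functions: the elements of `C_c^∞(Ω)`. -/
def IsTestFunction {D : ℕ} (Ω : Set (E D)) (φ : E D → ℝ) : Prop :=
  ContDiff ℝ ∞ φ ∧ HasCompactSupport φ ∧ tsupport φ ⊆ Ω

/-- `u ∈ W^{1,p}(Ω)` with weak gradient `G`. -/
structure IsSobolev {D : ℕ} (p : ℝ) (Ω : Set (E D)) (u : E D → ℝ) (G : E D → E D) : Prop where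
  memLp : MemLp u (ENNReal.ofReal p) (volume.restrict Ω)
  memLp_grad : MemLp G (ENNReal.ofReal p) (volume.restrict Ω)
  weak_grad : ∀ φ : E D → ℝ, IsTestFunction Ω φ →
    ∫ x in Ω, u x • gradient φ x = -∫ x in Ω, φ x • G x

/-- `u ∈ W_0^{1,p}(Ω)` with weak gradient `G`: membership in `W^{1,p}(Ω)` together with
approximability by test functions in the norm of `W^{1,p}(Ω)`. -/
def IsSobolevZero {D : ℕ} (p : ℝ) (Ω : Set (E D)) (u : E D → ℝ) (G : E D → E D) : Prop :=
  IsSobolev p Ω u G ∧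
    ∃ φ : ℕ → E D → ℝ, (∀ n, IsTestFunction Ω (φ n)) ∧
      Tendsto (fun n => eLpNorm (fun x => u x - φ n x) (ENNReal.ofReal p) (volume.restrict Ω))
        atTop (𝓝 0) ∧
      Tendsto (fun n => eLpNorm (fun x => G x - gradient (φ n) x) (ENNReal.ofReal p)
        (volume.restrict Ω)) atTop (𝓝 0)

/-- `u` is a weak solution in `W_0^{1,p}(Ω)` of `-div (|∇u|^{p-2} ∇u) = 1` in `Ω`, `u = 0` on
the boundary of `Ω`. -/
def IsTorsionFunction {D : ℕ} (p : ℝ) (Ω : Set (E D)) (u : E D → ℝ) : Prop :=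
  ∃ G : E D → E D, IsSobolevZero p Ω u G ∧
    ∀ φ : E D → ℝ, IsTestFunction Ω φ →
      ∫ x in Ω, inner ℝ (‖G x‖ ^ (p - 2) • G x) (gradient φ x) = ∫ x in Ω, φ x

open Classical in
/-- The `p`-torsion function of `Ω` (zero if there is no weak solution). -/
def torsionFunction {D : ℕ} (p : ℝ) (Ω : Set (E D)) : E D → ℝ :=
  if h : ∃ u, IsTorsionFunction p Ω u then h.choose else 0

/-- The `p`-torsional rigidity `T_p(Ω)`, the integral of the `p`-torsion function. -/
def torsionalRigidity {D : ℕ} (p : ℝ) (Ω : Set (E D)) : ℝ :=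
  ∫ x in Ω, torsionFunction p Ω x

/-- The normalized `p`-torsional rigidity `T(p;Ω) = |Ω|^{p-1} T_p(Ω)^{1-p}`. -/
def normRigidity {D : ℕ} (p : ℝ) (Ω : Set (E D)) : ℝ :=
  volume.real Ω ^ (p - 1) * torsionalRigidity p Ω ^ (1 - p)

/-- The scale-invariant quantity
`Q_p(Ω) = (T(p;Ω) R_Ω^p / ((2p-1)/(p-1))^{p-1})^{1/p}`. -/
def Q {D : ℕ} (p : ℝ) (Ω : Set (E D)) : ℝ :=
  (normRigidity p Ω * inradius Ω ^ p / ((2 * p - 1) / (p - 1)) ^ (p - 1)) ^ (1 / p)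

/-- The infimum of `Q_p` over all convex domains. -/
def alpha (D : ℕ) (p : ℝ) : ℝ := ⨅ Ω : convexDomains D, Q p (Ω : Set (E D))

/-- The supremum of `Q_p` over all convex domains. -/
def beta (D : ℕ) (p : ℝ) : ℝ := ⨆ Ω : convexDomains D, Q p (Ω : Set (E D))

/-- The constant `γ_{D,p}`. -/
def gammaDp (D : ℕ) (p : ℝ) : ℝ := alpha D p / beta D p

/-- The constant `γ_D`, the infimum of `γ_{D,p}` over `p ∈ (1,∞)`. -/
def gammaD (D : ℕ) : ℝ := ⨅ p : Set.Ioi (1 : ℝ), gammaDp D (p : ℝ)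

end PTorsion

end

namespace PTorsion

variable {D : ℕ} {Ω : Set (E D)} {p q : ℝ} {φ ψ : E D → ℝ}

lemma norm_gradient (φ : E D → ℝ) (x : E D) : ‖gradient φ x‖ = ‖fderiv ℝ φ x‖ := by
  simp [gradient]

lemma inner_gradient (φ : E D → ℝ) (x v : E D) :
    inner ℝ (gradient φ x) v = fderiv ℝ φ x v := by
  simp [gradient]

namespace IsTestFunction

lemma continuous (h : IsTestFunction Ω φ) : Continuous φ := h.1.continuous

lemma differentiable (h : IsTestFunction Ω φ) : Differentiable ℝ φ :=
  h.1.differentiable (by simp)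

lemma continuous_gradient (h : IsTestFunction Ω φ) : Continuous (gradient φ) :=
  (InnerProductSpace.toDual ℝ (E D)).symm.continuous.comp (h.1.continuous_fderiv (by simp))

lemma tsupport_gradient_subset (φ : E D → ℝ) : tsupport (gradient φ) ⊆ tsupport φ := by
  refine closure_minimal (fun x hx => ?_) (isClosed_tsupport φ)
  have : fderiv ℝ φ x ≠ 0 := fun h0 => hx (by simp [gradient, h0])
  exact support_fderiv_subset ℝ this

lemma hasCompactSupport_gradient (h : IsTestFunction Ω φ) : HasCompactSupport (gradient φ) :=
  h.2.1.of_isClosed_subset (isClosed_tsupport _) (tsupport_gradient_subset φ)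

lemma eq_zero (h : IsTestFunction Ω φ) {x : E D} (hx : x ∉ Ω) : φ x = 0 :=
  image_eq_zero_of_notMem_tsupport fun hx' => hx (h.2.2 hx')

lemma gradient_eq_zero (h : IsTestFunction Ω φ) {x : E D} (hx : x ∉ Ω) : gradient φ x = 0 :=
  image_eq_zero_of_notMem_tsupport fun hx' => hx (h.2.2 (tsupport_gradient_subset φ hx'))

lemma zero (Ω : Set (E D)) : IsTestFunction Ω (0 : E D → ℝ) :=
  ⟨contDiff_const, HasCompactSupport.zero, by simp [tsupport]⟩

lemma add (h : IsTestFunction Ω φ) (h' : IsTestFunction Ω ψ) :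
    IsTestFunction Ω (fun x => φ x + ψ x) :=
  ⟨h.1.add h'.1, h.2.1.add h'.2.1,
    (tsupport_add φ ψ).trans (Set.union_subset h.2.2 h'.2.2)⟩

lemma const_mul (h : IsTestFunction Ω φ) (c : ℝ) : IsTestFunction Ω (fun x => c * φ x) :=
  ⟨contDiff_const.mul h.1, h.2.1.mul_left,
    (tsupport_mul_subset_right (f := fun _ => c) (g := φ)).trans h.2.2⟩

lemma gradient_add (h : IsTestFunction Ω φ) (h' : IsTestFunction Ω ψ) (x : E D) :
    gradient (fun x => φ x + ψ x) x = gradient φ x + gradient ψ x := by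
  simp only [gradient]
  rw [fderiv_fun_add (h.differentiable x) (h'.differentiable x), map_add]

lemma gradient_const_mul (h : IsTestFunction Ω φ) (c : ℝ) (x : E D) :
    gradient (fun x => c * φ x) x = c • gradient φ x := by
  simp only [gradient]
  rw [fderiv_const_mul (h.differentiable x), map_smul]

lemma sub (h : IsTestFunction Ω φ) (h' : IsTestFunction Ω ψ) :
    IsTestFunction Ω (fun x => φ x - ψ x) := by
  simpa [sub_eq_add_neg] using h.add (h'.const_mul (-1))

lemma gradient_sub (h : IsTestFunction Ω φ) (h' : IsTestFunction Ω ψ) (x : E D) :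
    gradient (fun x => φ x - ψ x) x = gradient φ x - gradient ψ x := by
  simp only [gradient]
  rw [fderiv_fun_sub (h.differentiable x) (h'.differentiable x), map_sub]

lemma memLp (h : IsTestFunction Ω φ) (r : ENNReal) (μ : Measure (E D))
    [IsFiniteMeasureOnCompacts μ] : MemLp φ r μ :=
  h.continuous.memLp_of_hasCompactSupport h.2.1

lemma memLp_gradient (h : IsTestFunction Ω φ) (r : ENNReal) (μ : Measure (E D))
    [IsFiniteMeasureOnCompacts μ] : MemLp (gradient φ) r μ :=
  h.continuous_gradient.memLp_of_hasCompactSupport h.hasCompactSupport_gradient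

lemma integrable (h : IsTestFunction Ω φ) : Integrable φ :=
  h.continuous.integrable_of_hasCompactSupport h.2.1

lemma continuous_norm_gradient_rpow (h : IsTestFunction Ω φ) (hp : 0 ≤ p) :
    Continuous fun x => ‖gradient φ x‖ ^ p :=
  h.continuous_gradient.norm.rpow_const fun _ => Or.inr hp

lemma integrable_norm_gradient_rpow (h : IsTestFunction Ω φ) (hp : 0 < p) :
    Integrable fun x => ‖gradient φ x‖ ^ p :=
  (h.continuous_norm_gradient_rpow hp.le).integrable_of_hasCompactSupport
    (h.hasCompactSupport_gradient.comp_left (g := fun v => ‖v‖ ^ p)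
      (by simp [Real.zero_rpow hp.ne']))

lemma integrable_norm_rpow (h : IsTestFunction Ω φ) (hp : 0 < p) :
    Integrable fun x => ‖φ x‖ ^ p :=
  (h.continuous.norm.rpow_const fun _ => Or.inr hp.le).integrable_of_hasCompactSupport
    (h.2.1.comp_left (g := fun v => ‖v‖ ^ p) (by simp [Real.zero_rpow hp.ne']))

lemma setIntegral_eq (h : IsTestFunction Ω φ) : ∫ x in Ω, φ x = ∫ x, φ x :=
  setIntegral_eq_integral_of_forall_compl_eq_zero fun _ hx => h.eq_zero hx

lemma setIntegral_norm_gradient_rpow_eq (h : IsTestFunction Ω φ) (hp : 0 < p) :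
    ∫ x in Ω, ‖gradient φ x‖ ^ p = ∫ x, ‖gradient φ x‖ ^ p :=
  setIntegral_eq_integral_of_forall_compl_eq_zero fun _ hx => by
    simp [h.gradient_eq_zero hx, Real.zero_rpow hp.ne']

lemma setIntegral_norm_rpow_eq (h : IsTestFunction Ω φ) (hp : 0 < p) :
    ∫ x in Ω, ‖φ x‖ ^ p = ∫ x, ‖φ x‖ ^ p :=
  setIntegral_eq_integral_of_forall_compl_eq_zero fun _ hx => by
    simp [h.eq_zero hx, Real.zero_rpow hp.ne']

lemma integral_smul_gradient (h : IsTestFunction Ω φ) (h' : IsTestFunction Ω ψ) :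
    ∫ x, φ x • gradient ψ x = -∫ x, ψ x • gradient φ x := by
  have key : ∀ {f g : E D → ℝ}, IsTestFunction Ω f → IsTestFunction Ω g →
      Integrable (fun x => f x • gradient g x) := fun {f g} hf hg =>
    (hf.continuous.smul hg.continuous_gradient).integrable_of_hasCompactSupport
      (hf.2.1.smul_right)
  refine ext_inner_left ℝ fun v : E D => ?_
  rw [inner_neg_right, ← integral_inner (key h h'), ← integral_inner (key h' h)]
  have e : ∀ {f g : E D → ℝ} (x : E D),
      inner ℝ v (f x • gradient g x) = f x * fderiv ℝ g x v := by
    intro f g x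
    rw [inner_smul_right, real_inner_comm, inner_gradient]
  have key' : ∀ {f g : E D → ℝ}, IsTestFunction Ω f → IsTestFunction Ω g →
      Integrable (fun x => f x * fderiv ℝ g x v) := fun {f g} hf hg => by
    simpa only [e] using (key hf hg).const_inner (𝕜 := ℝ) v
  simp only [e]
  rw [integral_mul_fderiv_eq_neg_fderiv_mul_of_integrable (by simpa [mul_comm] using key' h' h)
    (key' h h') ((h.continuous.mul h'.continuous).integrable_of_hasCompactSupport h.2.1.mul_right)
    (fun x _ => h.differentiable x) (fun x _ => h'.differentiable x)]
  simp [mul_comm]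

end IsTestFunction

/-- The concave functional `∫ φ - (1/p) ∫ |∇φ|^p` maximised by the torsion function. -/
noncomputable def energy (p : ℝ) (φ : E D → ℝ) : ℝ :=
  (∫ x, φ x) - (1 / p) * ∫ x, ‖gradient φ x‖ ^ p

lemma norm_midpoint_rpow_lt (hp : 1 < p) {a b : E D} (hab : a ≠ b) :
    ‖(1 / 2 : ℝ) • (a + b)‖ ^ p < (‖a‖ ^ p + ‖b‖ ^ p) / 2 := by
  have hp0 : 0 < p := by linarith
  have h1 : ‖(1 / 2 : ℝ) • (a + b)‖ ≤ (‖a‖ + ‖b‖) / 2 := by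
    rw [norm_smul, Real.norm_of_nonneg (by norm_num)]
    linarith [norm_add_le a b]
  by_cases hn : ‖a‖ = ‖b‖
  · have h2 : ‖(1 / 2 : ℝ) • (a + b)‖ < ‖a‖ := by
      have hne : ¬ SameRay ℝ a b := fun hs => hab ((sameRay_iff_of_norm_eq hn).1 hs)
      have := norm_add_lt_of_not_sameRay hne
      rw [norm_smul, Real.norm_of_nonneg (by norm_num)]
      linarith
    have := Real.rpow_lt_rpow (norm_nonneg _) h2 hp0
    rw [← hn]; linarith
  · have h3 := (strictConvexOn_rpow hp).2 (norm_nonneg a) (norm_nonneg b) hn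
      (by norm_num : (0 : ℝ) < 1 / 2) (by norm_num : (0 : ℝ) < 1 / 2) (by norm_num)
    simp only [smul_eq_mul] at h3
    have h4 := Real.rpow_le_rpow (norm_nonneg _) h1 hp0.le
    have h5 : (‖a‖ + ‖b‖) / 2 = 1 / 2 * ‖a‖ + 1 / 2 * ‖b‖ := by ring
    rw [h5] at h4
    linarith

lemma norm_midpoint_rpow_le (hp : 1 < p) (a b : E D) :
    ‖(1 / 2 : ℝ) • (a + b)‖ ^ p ≤ (‖a‖ ^ p + ‖b‖ ^ p) / 2 := by
  by_cases hab : a = b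
  · subst hab
    have : (1 / 2 : ℝ) • (a + a) = a := by rw [← two_smul ℝ a, smul_smul]; norm_num
    rw [this]; linarith
  · exact (norm_midpoint_rpow_lt hp hab).le

lemma norm_sub_rpow_le_of_midpoint (hp : 1 < p) {ε : ℝ} (hε : 0 < ε) :
    ∃ K : ℝ, 0 ≤ K ∧ ∀ a b : E D, ‖a - b‖ ^ p ≤ ε * (‖a‖ ^ p + ‖b‖ ^ p) +
      K * ((‖a‖ ^ p + ‖b‖ ^ p) / 2 - ‖(1 / 2 : ℝ) • (a + b)‖ ^ p) := by
  have hp0 : 0 < p := by linarith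
  set gap : E D × E D → ℝ := fun z => (‖z.1‖ ^ p + ‖z.2‖ ^ p) / 2 - ‖(1 / 2 : ℝ) • (z.1 + z.2)‖ ^ p
    with hgap
  have hgap0 : ∀ z, 0 ≤ gap z := fun z => sub_nonneg.2 (norm_midpoint_rpow_le hp z.1 z.2)
  have cpow : ∀ {f : E D × E D → E D}, Continuous f → Continuous fun z => ‖f z‖ ^ p :=
    fun hf => hf.norm.rpow_const fun _ => Or.inr hp0.le
  have c1 := cpow continuous_fst
  have c2 := cpow continuous_snd
  have c3 := cpow (continuous_fst.sub continuous_snd)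
  have cg : Continuous gap := ((c1.add c2).div_const 2).sub
    (cpow (f := fun z => (1 / 2 : ℝ) • (z.1 + z.2)) (by fun_prop))
  set S : Set (E D × E D) := {z | ‖z.1‖ ^ p + ‖z.2‖ ^ p = 1 ∧ ε ≤ ‖z.1 - z.2‖ ^ p} with hS
  have hle1 : ∀ z ∈ S, ‖z.1‖ ≤ 1 ∧ ‖z.2‖ ≤ 1 := by
    rintro z ⟨hz, -⟩
    have n1 := Real.rpow_nonneg (norm_nonneg z.1) p
    have n2 := Real.rpow_nonneg (norm_nonneg z.2) p
    constructor <;> by_contra! hlt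
    · linarith [Real.one_lt_rpow hlt hp0]
    · linarith [Real.one_lt_rpow hlt hp0]
  have hScomp : IsCompact S := by
    refine Metric.isCompact_of_isClosed_isBounded
      ((isClosed_eq (c1.add c2) continuous_const).inter (isClosed_le continuous_const c3)) ?_
    refine (Metric.isBounded_closedBall (x := (0 : E D × E D)) (r := 1)).subset fun z hz => ?_
    simpa [Prod.norm_def] using hle1 z hz
  obtain ⟨δ, hδ, hδS⟩ : ∃ δ > 0, ∀ z ∈ S, δ ≤ gap z := by
    rcases S.eq_empty_or_nonempty with h | h
    · exact ⟨1, one_pos, by simp [h]⟩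
    · obtain ⟨z, hz, hmin⟩ := hScomp.exists_isMinOn h cg.continuousOn
      refine ⟨gap z, sub_pos.2 (norm_midpoint_rpow_lt hp ?_), fun w hw => hmin hw⟩
      intro h0
      have := hz.2
      rw [h0, sub_self, norm_zero, Real.zero_rpow hp0.ne'] at this
      linarith
  have unit : ∀ z : E D × E D, ‖z.1‖ ^ p + ‖z.2‖ ^ p = 1 →
      ‖z.1 - z.2‖ ^ p ≤ ε + 2 ^ p / δ * gap z := by
    intro z hz
    have hpos : 0 ≤ 2 ^ p / δ * gap z := mul_nonneg (by positivity) (hgap0 z)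
    by_cases hε' : ε ≤ ‖z.1 - z.2‖ ^ p
    · have hzS : z ∈ S := ⟨hz, hε'⟩
      have h2 : ‖z.1 - z.2‖ ≤ 2 := by
        linarith [norm_sub_le z.1 z.2, (hle1 z hzS).1, (hle1 z hzS).2]
      have h3 := Real.rpow_le_rpow (norm_nonneg _) h2 hp0.le
      have h4 : 2 ^ p / δ * δ ≤ 2 ^ p / δ * gap z :=
        mul_le_mul_of_nonneg_left (hδS z hzS) (by positivity)
      rw [div_mul_cancel₀ _ hδ.ne'] at h4
      linarith
    · linarith
  refine ⟨2 ^ p / δ, by positivity, fun a b => ?_⟩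
  set s := ‖a‖ ^ p + ‖b‖ ^ p with hs
  have n1 := Real.rpow_nonneg (norm_nonneg a) p
  have n2 := Real.rpow_nonneg (norm_nonneg b) p
  rcases (add_nonneg n1 n2).eq_or_lt with h0 | hpos
  · have ha : ‖a‖ ^ p = 0 := by linarith
    have hb : ‖b‖ ^ p = 0 := by linarith
    rw [Real.rpow_eq_zero (norm_nonneg _) hp0.ne', norm_eq_zero] at ha hb
    simp [hs, ha, hb, Real.zero_rpow hp0.ne']
  · rw [← hs] at hpos
    set t := (s ^ (1 / p))⁻¹ with ht
    have hstp : t ^ p = s⁻¹ := by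
      rw [ht, Real.inv_rpow (by positivity), ← Real.rpow_mul hpos.le, one_div_mul_cancel hp0.ne',
        Real.rpow_one]
    have htpos : 0 < t := by positivity
    have hn : ∀ v : E D, ‖t • v‖ ^ p = s⁻¹ * ‖v‖ ^ p := fun v => by
      rw [norm_smul, Real.norm_of_nonneg htpos.le, Real.mul_rpow htpos.le (norm_nonneg _), hstp]
    have := unit (t • a, t • b) (by
      simp only [hn]; rw [← mul_add, ← hs]; exact inv_mul_cancel₀ hpos.ne')
    simp only [hgap] at this
    rw [← smul_sub, ← smul_add, smul_comm, hn, hn, hn, hn] at this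
    have h5 := mul_le_mul_of_nonneg_left this hpos.le
    have h6 : s * s⁻¹ = 1 := mul_inv_cancel₀ hpos.ne'
    calc ‖a - b‖ ^ p = s * (s⁻¹ * ‖a - b‖ ^ p) := by rw [← mul_assoc, h6, one_mul]
      _ ≤ _ := h5
      _ = _ := by
        simp only [← mul_add, ← mul_sub, mul_div_assoc]
        rw [← hs]
        linear_combination (2 ^ p / δ) * (s / 2 - ‖(1 / 2 : ℝ) • (a + b)‖ ^ p) * h6

/-- A function all of whose integrals along the lines of direction `ν` are nonpositive has
nonpositive integral. -/
lemma integral_nonpos_of_line_integral_nonpos {F : E D → ℝ} (hFm : Measurable F)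
    (hF : Integrable F) {ν : E D} (hν : ‖ν‖ = 1)
    (h : ∀ x, ∫ t : ℝ, F (x + t • ν) ≤ 0) : ∫ x, F x ≤ 0 := by
  set w : E D → ℝ := fun x => (Set.Ico (0 : ℝ) 1).indicator (fun _ => (1 : ℝ)) (inner ℝ ν x) with hw
  have hwm : Measurable w := (measurable_const.indicator measurableSet_Ico).comp
    (continuous_const.inner continuous_id).measurable
  have hw0 : ∀ x, 0 ≤ w x := fun x => Set.indicator_nonneg (fun _ _ => zero_le_one) _
  have hwt : ∀ y t, w (y - t • ν) =
      (Set.Ioc (inner ℝ ν y - 1) (inner ℝ ν y)).indicator (fun _ => (1 : ℝ)) t := by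
    intro y t
    have : inner ℝ ν (y - t • ν) = inner ℝ ν y - t := by
      rw [inner_sub_right, inner_smul_right, real_inner_self_eq_norm_sq, hν]; ring
    simp only [hw, this, Set.indicator_apply, Set.mem_Ico, Set.mem_Ioc]
    congr 1
    apply propext
    constructor <;> rintro ⟨h1, h2⟩ <;> constructor <;> linarith
  have hwint : ∀ y, ∫ t : ℝ, w (y - t • ν) = 1 := by
    intro y
    simp only [hwt]
    rw [integral_indicator measurableSet_Ioc]
    simp
  have hwI : ∀ y, Integrable fun t : ℝ => w (y - t • ν) := by
    intro y
    simp only [hwt]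
    exact (integrable_indicator_iff measurableSet_Ioc).2 (by simp)
  have m1 : Measurable fun z : E D × ℝ => w (z.1 - z.2 • ν) * F z.1 :=
    (hwm.comp (by fun_prop)).mul (hFm.comp measurable_fst)
  have I1 : Integrable (fun z : E D × ℝ => w (z.1 - z.2 • ν) * F z.1) (volume.prod volume) := by
    rw [integrable_prod_iff m1.aestronglyMeasurable]
    refine ⟨ae_of_all _ fun y => (hwI y).mul_const (F y), ?_⟩
    have : ∀ y, ∫ t : ℝ, ‖w (y - t • ν) * F y‖ = ‖F y‖ := by
      intro y
      simp only [norm_mul, Real.norm_of_nonneg (hw0 _)]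
      rw [integral_mul_const, hwint, one_mul]
    simpa only [this] using hF.norm
  have shift : ∀ t : ℝ, ∀ g : ℝ → ℝ, ∫ x, w x * g (F (x + t • ν)) = ∫ y, w (y - t • ν) * g (F y) := by
    intro t g
    rw [← integral_add_right_eq_self (fun y => w (y - t • ν) * g (F y)) (t • ν)]
    simp
  have m2 : Measurable fun z : E D × ℝ => w z.1 * F (z.1 + z.2 • ν) :=
    (hwm.comp measurable_fst).mul (hFm.comp (by fun_prop))
  have I2 : Integrable (fun z : E D × ℝ => w z.1 * F (z.1 + z.2 • ν)) (volume.prod volume) := by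
    rw [integrable_prod_iff' m2.aestronglyMeasurable]
    constructor
    · have := ((integrable_prod_iff' m1.aestronglyMeasurable).1 I1).1
      filter_upwards [this] with t ht
      simpa using ht.comp_add_right (t • ν)
    · have := ((integrable_prod_iff' m1.aestronglyMeasurable).1 I1).2
      refine this.congr (ae_of_all _ fun t => ?_)
      simp only [norm_mul, Real.norm_of_nonneg (hw0 _)]
      exact (shift t norm).symm
  calc ∫ y, F y = ∫ y, ∫ t : ℝ, w (y - t • ν) * F y := by
        simp only [integral_mul_const, hwint, one_mul]
    _ = ∫ t : ℝ, ∫ y, w (y - t • ν) * F y := integral_integral_swap I1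
    _ = ∫ t : ℝ, ∫ x, w x * F (x + t • ν) := by
        congr 1 with t; exact (shift t id).symm
    _ = ∫ x, ∫ t : ℝ, w x * F (x + t • ν) := (integral_integral_swap I2).symm
    _ ≤ 0 := by
        refine integral_nonpos fun x => ?_
        simp only [integral_const_mul]
        exact mul_nonpos_of_nonneg_of_nonpos (hw0 x) (h x)

lemma IsTestFunction.hasDerivAt_line (h : IsTestFunction Ω φ) (x v : E D) (t : ℝ) :
    HasDerivAt (fun t : ℝ => φ (x + t • v)) (inner ℝ (gradient φ (x + t • v)) v) t := by
  rw [inner_gradient]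
  have h1 : HasDerivAt (fun t : ℝ => x + t • v) v t := by
    simpa using ((hasDerivAt_id t).smul_const v).const_add x
  exact (h.differentiable (x + t • v)).hasFDerivAt.comp_hasDerivAt t h1

/-- The one-dimensional Makai inequality, on an interval of length at most `R`. -/
lemma intervalIntegral_makai (hpq : p.HolderConjugate q) {f g : ℝ → ℝ} {a c R : ℝ}
    (hac : a ≤ c) (hR : c - a ≤ R) (hf : ∀ t, HasDerivAt f (g t) t) (hg : Continuous g)
    (hc : f c = 0) :
    ∫ t in a..c, (f t - (1 / p) * |g t| ^ p - R ^ q / (q * (q + 1))) ≤ 0 := by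
  have hq0 : 0 < q := hpq.symm.pos
  have hp0 : 0 < p := hpq.pos
  have hfc : Continuous f := continuous_iff_continuousAt.2 fun t => (hf t).continuousAt
  have cgp : Continuous fun t => |g t| ^ p := hg.abs.rpow_const fun _ => Or.inr hp0.le
  have ctq : Continuous fun t : ℝ => |t - a| ^ q :=
    (continuous_id.sub continuous_const).abs.rpow_const fun _ => Or.inr hq0.le
  have parts := intervalIntegral.integral_mul_deriv_eq_deriv_mul (a := a) (b := c)
    (u := fun t => t - a) (u' := fun _ => 1) (v := f) (v' := g)
    (fun t _ => (hasDerivAt_id t).sub_const a) (fun t _ => hf t)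
    (by simp) (hg.intervalIntegrable _ _)
  simp only [hc, sub_self, zero_mul, mul_zero, one_mul, zero_sub] at parts
  have young : ∀ t, -((t - a) * g t) ≤ |g t| ^ p / p + |t - a| ^ q / q := by
    intro t
    have h1 := Real.young_inequality_of_nonneg (abs_nonneg (g t)) (abs_nonneg (t - a)) hpq
    have h2 : -((t - a) * g t) ≤ |g t| * |t - a| := by
      rw [← abs_mul, mul_comm]; exact neg_le_abs _
    linarith
  have hmono : ∫ t in a..c, -((t - a) * g t) ≤
      ∫ t in a..c, (|g t| ^ p / p + |t - a| ^ q / q) :=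
    intervalIntegral.integral_mono_on hac (Continuous.intervalIntegrable (by fun_prop) _ _)
      (Continuous.intervalIntegrable (by fun_prop) _ _) fun t _ => young t
  rw [intervalIntegral.integral_neg, parts, neg_neg,
    intervalIntegral.integral_add ((cgp.div_const p).intervalIntegrable _ _)
      ((ctq.div_const q).intervalIntegrable _ _)] at hmono
  have hpow : ∫ t in a..c, |t - a| ^ q / q ≤ (c - a) * (R ^ q / (q * (q + 1))) := by
    have e : ∫ t in a..c, |t - a| ^ q / q = (c - a) ^ (q + 1) / (q + 1) / q := by
      rw [intervalIntegral.integral_div]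
      congr 1
      have : ∫ t in a..c, |t - a| ^ q = ∫ t in a..c, (t - a) ^ q := by
        refine intervalIntegral.integral_congr fun t ht => ?_
        rw [Set.uIcc_of_le hac] at ht
        simp only [abs_of_nonneg (sub_nonneg.2 ht.1)]
      rw [this, intervalIntegral.integral_comp_sub_right (fun t => t ^ q) a,
        integral_rpow (Or.inl (by linarith)), sub_self, Real.zero_rpow (by linarith), sub_zero]
    rw [e]
    have h0 : 0 ≤ c - a := sub_nonneg.2 hac
    rw [Real.rpow_add_one' h0 (by linarith)]
    have := Real.rpow_le_rpow h0 hR hq0.le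
    have h2 : (c - a) ^ q * (c - a) ≤ R ^ q * (c - a) := mul_le_mul_of_nonneg_right this h0
    calc (c - a) ^ q * (c - a) / (q + 1) / q ≤ R ^ q * (c - a) / (q + 1) / q := by gcongr
      _ = _ := by field_simp
  have hIf := hfc.intervalIntegrable (μ := volume) a c
  have hIg : IntervalIntegrable (fun t => 1 / p * |g t| ^ p) volume a c :=
    (continuous_const.mul cgp).intervalIntegrable _ _
  rw [intervalIntegral.integral_sub (hIf.sub hIg) (by simp), intervalIntegral.integral_sub hIf hIg]
  simp only [intervalIntegral.integral_const, smul_eq_mul]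
  have e2 : ∫ t in a..c, |g t| ^ p / p = ∫ t in a..c, 1 / p * |g t| ^ p := by
    congr 1 with t; ring
  rw [e2] at hmono
  linarith

/-- The open polyhedron cut out by the half-spaces `⟪ν i, x⟫ < c i`. -/
def polyhedron {n : ℕ} (ν : Fin n → E D) (c : Fin n → ℝ) : Set (E D) :=
  {x | ∀ i, inner ℝ (ν i) x < c i}

/-- The points of a polyhedron whose nearest face is the `i`-th one, ties being broken by the
order of the faces. -/
def nearestFaceCell {n : ℕ} (ν : Fin n → E D) (c : Fin n → ℝ) (i : Fin n) : Set (E D) :=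
  {x | x ∈ polyhedron ν c ∧ (∀ j, c i - inner ℝ (ν i) x ≤ c j - inner ℝ (ν j) x) ∧
    ∀ j < i, c i - inner ℝ (ν i) x < c j - inner ℝ (ν j) x}

section Polyhedron

variable {n : ℕ} {ν : Fin n → E D} {c : Fin n → ℝ}

lemma isOpen_polyhedron : IsOpen (polyhedron ν c) := by
  simp only [polyhedron, Set.ofPred_forall]
  exact isOpen_iInter_of_finite fun i =>
    isOpen_lt (continuous_const.inner continuous_id) continuous_const

lemma measurableSet_nearestFaceCell (i : Fin n) : MeasurableSet (nearestFaceCell ν c i) := by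
  have hm : ∀ j, Measurable fun x : E D => c j - inner ℝ (ν j) x := fun j =>
    (continuous_const.sub (continuous_const.inner continuous_id)).measurable
  refine isOpen_polyhedron.measurableSet.inter (MeasurableSet.inter ?_ ?_)
  · exact measurableSet_setOfPred.2 (Measurable.forall fun j =>
      measurableSet_setOfPred.1 (measurableSet_le (hm i) (hm j)))
  · exact measurableSet_setOfPred.2 (Measurable.forall fun j => Measurable.imp measurable_const
      (measurableSet_setOfPred.1 (measurableSet_lt (hm i) (hm j))))

lemma iUnion_nearestFaceCell [NeZero n] : ⋃ i, nearestFaceCell ν c i = polyhedron ν c := by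
  refine Set.Subset.antisymm (Set.iUnion_subset fun i x hx => hx.1) fun x hx => ?_
  obtain ⟨i₀, -, h₀⟩ := Finset.exists_min_image Finset.univ
    (fun i => c i - inner ℝ (ν i) x) Finset.univ_nonempty
  set s : Finset (Fin n) := Finset.univ.filter
    fun i => ∀ j, c i - inner ℝ (ν i) x ≤ c j - inner ℝ (ν j) x with hs
  have hsne : s.Nonempty := ⟨i₀, by simpa [hs] using h₀⟩
  have hmin := s.min'_mem hsne
  simp only [hs, Finset.mem_filter, Finset.mem_univ, true_and] at hmin
  refine Set.mem_iUnion.2 ⟨s.min' hsne, hx, hmin, fun j hj => ?_⟩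
  by_contra! hle
  have : j ∈ s := by
    simp only [hs, Finset.mem_filter, Finset.mem_univ, true_and]
    exact fun k => hle.trans (hmin k)
  exact absurd (s.min'_le j this) (not_le.2 hj)

lemma pairwise_disjoint_nearestFaceCell :
    Pairwise (Function.onFun Disjoint (nearestFaceCell ν c)) := by
  intro i j hij
  refine Set.disjoint_left.2 fun x hi hj => ?_
  rcases lt_or_gt_of_ne hij with h | h
  · exact absurd (hj.2.2 i h) (not_lt.2 (hi.2.1 j))
  · exact absurd (hi.2.2 j h) (not_lt.2 (hj.2.1 i))

lemma inner_add_smul_self {v : E D} (hv : ‖v‖ = 1) (x : E D) (t : ℝ) :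
    inner ℝ v (x + t • v) = inner ℝ v x + t := by
  rw [inner_add_right, inner_smul_right, real_inner_self_eq_norm_sq, hv]; ring

lemma inner_le_of_norm_eq_one {v w : E D} (hv : ‖v‖ = 1) : inner ℝ v w ≤ ‖w‖ := by
  simpa [hv] using real_inner_le_norm v w

/-- Moving towards the nearest face does not change the nearest face. -/
lemma add_smul_mem_nearestFaceCell (hν : ∀ i, ‖ν i‖ = 1) {i : Fin n} {x : E D}
    (hx : x ∈ nearestFaceCell ν c i) {s : ℝ} (hs : 0 ≤ s) (hsc : s < c i - inner ℝ (ν i) x) :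
    x + s • ν i ∈ nearestFaceCell ν c i := by
  have hii := inner_add_smul_self (hν i) x s
  have hij : ∀ j, inner ℝ (ν j) (x + s • ν i) ≤ inner ℝ (ν j) x + s := fun j => by
    rw [inner_add_right]
    have : inner ℝ (ν j) (s • ν i) ≤ s := (inner_le_of_norm_eq_one (hν j)).trans
      (by rw [norm_smul, hν i, Real.norm_of_nonneg hs, mul_one])
    linarith
  refine ⟨fun j => ?_, fun j => ?_, fun j hj => ?_⟩
  · linarith [hij j, hx.2.1 j]
  · linarith [hij j, hx.2.1 j]
  · linarith [hij j, hx.2.2 j hj]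

lemma ball_subset_polyhedron (hν : ∀ i, ‖ν i‖ = 1) {i : Fin n} {x : E D}
    (hx : x ∈ nearestFaceCell ν c i) :
    Metric.ball x (c i - inner ℝ (ν i) x) ⊆ polyhedron ν c := by
  intro y hy j
  have h1 : inner ℝ (ν j) (y - x) ≤ ‖y - x‖ := inner_le_of_norm_eq_one (hν j)
  rw [Metric.mem_ball, dist_eq_norm] at hy
  rw [inner_sub_right] at h1
  linarith [hx.2.1 j]

lemma setIntegral_nearestFaceCell_nonpos (hpq : p.HolderConjugate q) (hν : ∀ i, ‖ν i‖ = 1) {R : ℝ}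
    (hR : ∀ x r, 0 < r → Metric.ball x r ⊆ polyhedron ν c → r ≤ R)
    (hb : Bornology.IsBounded (polyhedron ν c)) (h : IsTestFunction (polyhedron ν c) φ)
    (i : Fin n) :
    ∫ x in nearestFaceCell ν c i,
      (φ x - (1 / p) * ‖gradient φ x‖ ^ p - R ^ q / (q * (q + 1))) ≤ 0 := by
  have hp0 := hpq.pos
  set A := nearestFaceCell ν c i with hA
  set κ := R ^ q / (q * (q + 1)) with hκ
  set H : E D → ℝ := fun x => φ x - (1 / p) * ‖gradient φ x‖ ^ p - κ with hH
  have hAm : MeasurableSet A := measurableSet_nearestFaceCell i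
  have hAfin : volume A < ⊤ :=
    (measure_mono fun x hx => hx.1).trans_lt hb.measure_lt_top
  have cgp := h.continuous_norm_gradient_rpow hp0.le
  have cH : Continuous H := (h.continuous.sub (continuous_const.mul cgp)).sub continuous_const
  have hHI : IntegrableOn H A :=
    ((h.integrable.sub ((h.integrable_norm_gradient_rpow hp0).const_mul _)).integrableOn).sub
      (integrableOn_const hAfin.ne)
  rw [← integral_indicator hAm]
  refine integral_nonpos_of_line_integral_nonpos (cH.measurable.indicator hAm)
    ((integrable_indicator_iff hAm).2 hHI) (hν i) fun x => ?_
  set S : Set ℝ := {t | x + t • ν i ∈ A} with hS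
  set c' := c i - inner ℝ (ν i) x with hc'
  have hSm : MeasurableSet S := hAm.preimage (f := fun t : ℝ => x + t • ν i) (by fun_prop)
  have e1 : ∫ t : ℝ, A.indicator H (x + t • ν i) = ∫ t : ℝ in S, H (x + t • ν i) := by
    rw [← integral_indicator hSm]
    rfl
  rw [e1]
  rcases S.eq_empty_or_nonempty with hSe | hSne
  · simp [hSe]
  have hd : ∀ t, c i - inner ℝ (ν i) (x + t • ν i) = c' - t := fun t => by
    rw [inner_add_smul_self (hν i)]; ring
  have hSub : ∀ t ∈ S, t < c' ∧ c' - R ≤ t := by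
    intro t ht
    have h1 : 0 < c' - t := by rw [← hd]; exact sub_pos.2 (ht.1 i)
    have h2 := hR _ _ (by rw [hd]; exact h1) (ball_subset_polyhedron hν ht)
    rw [hd] at h2
    constructor <;> linarith
  have hbdd : BddBelow S := ⟨c' - R, fun t ht => (hSub t ht).2⟩
  set a := sInf S with ha
  have hac : a ≤ c' := by
    obtain ⟨t, ht⟩ := hSne
    exact (csInf_le hbdd ht).trans (hSub t ht).1.le
  have haR : c' - a ≤ R := by
    have : c' - R ≤ a := le_csInf hSne fun t ht => (hSub t ht).2
    linarith
  have hup : Set.Ioo a c' ⊆ S := by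
    rintro t ⟨hat, htc⟩
    obtain ⟨s, hs, hst⟩ := exists_lt_of_csInf_lt hSne hat
    have := add_smul_mem_nearestFaceCell hν hs (sub_nonneg.2 hst.le)
      (by rw [hd]; linarith)
    rwa [add_assoc, ← add_smul, add_sub_cancel] at this
  have hdown : S ⊆ Set.Icc a c' := fun t ht => ⟨csInf_le hbdd ht, (hSub t ht).1.le⟩
  have hae : S =ᵐ[volume] Set.Ioc a c' :=
    ((LE.le.eventuallyLE hdown).trans Ioc_ae_eq_Icc.symm.le).antisymm
      (Ioo_ae_eq_Ioc.symm.le.trans (LE.le.eventuallyLE hup))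
  rw [setIntegral_congr_set hae, ← intervalIntegral.integral_of_le hac]
  have hzero : φ (x + c' • ν i) = 0 := h.eq_zero fun hm => by
    have h1 := hm i
    have h2 := hd c'
    linarith
  have cl : Continuous fun t : ℝ => x + t • ν i := by fun_prop
  have cg : Continuous fun t : ℝ => inner ℝ (gradient φ (x + t • ν i)) (ν i) :=
    (h.continuous_gradient.comp cl).inner continuous_const
  refine le_trans ?_ (intervalIntegral_makai hpq hac haR (fun t => h.hasDerivAt_line x (ν i) t)
    cg hzero)
  refine intervalIntegral.integral_mono_on hac ((cH.comp cl).intervalIntegrable _ _)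
    (Continuous.intervalIntegrable ?_ _ _) fun t _ => ?_
  · exact ((h.continuous.comp cl).sub (continuous_const.mul
      (cg.abs.rpow_const fun _ => Or.inr hp0.le))).sub continuous_const
  · have : |inner ℝ (gradient φ (x + t • ν i)) (ν i)| ≤ ‖gradient φ (x + t • ν i)‖ := by
      simpa [hν i] using abs_real_inner_le_norm (gradient φ (x + t • ν i)) (ν i)
    have := Real.rpow_le_rpow (abs_nonneg _) this hp0.le
    have h1p : 0 ≤ 1 / p := by positivity
    simp only [hH]
    linarith [mul_le_mul_of_nonneg_left this h1p]

lemma energy_le_of_polyhedron (hpq : p.HolderConjugate q) (hν : ∀ i, ‖ν i‖ = 1) [NeZero n] {R : ℝ}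
    (hR : ∀ x r, 0 < r → Metric.ball x r ⊆ polyhedron ν c → r ≤ R)
    (hb : Bornology.IsBounded (polyhedron ν c)) (h : IsTestFunction (polyhedron ν c) φ) :
    energy p φ ≤ R ^ q / (q * (q + 1)) * volume.real (polyhedron ν c) := by
  have hp0 := hpq.pos
  have hfin : volume (polyhedron ν c) ≠ ⊤ := hb.measure_lt_top.ne
  have hI1 := h.integrable
  have hI2 := (h.integrable_norm_gradient_rpow hp0).const_mul (1 / p)
  have key : ∫ x in polyhedron ν c,
      (φ x - (1 / p) * ‖gradient φ x‖ ^ p - R ^ q / (q * (q + 1))) ≤ 0 := by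
    rw [← iUnion_nearestFaceCell, integral_iUnion_fintype measurableSet_nearestFaceCell
      pairwise_disjoint_nearestFaceCell fun i => ?_]
    · exact Finset.sum_nonpos fun i _ => setIntegral_nearestFaceCell_nonpos hpq hν hR hb h i
    · exact (hI1.sub hI2).integrableOn.sub (integrableOn_const
        ((measure_mono fun x hx => hx.1).trans_lt hb.measure_lt_top).ne)
  have hI12 : IntegrableOn (fun x => φ x - 1 / p * ‖gradient φ x‖ ^ p) (polyhedron ν c) :=
    (hI1.sub hI2).integrableOn
  rw [integral_sub hI12 (integrableOn_const hfin), integral_sub hI1.integrableOn hI2.integrableOn, h.setIntegral_eq, integral_const_mul,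
    h.setIntegral_norm_gradient_rpow_eq hp0, setIntegral_const, smul_eq_mul] at key
  unfold energy
  linarith

end Polyhedron

/-- A compact subset of a bounded convex open set can be separated from its boundary by
a polyhedron. -/
lemma exists_polyhedron_between (hD : 1 ≤ D) (hΩ : Ω ∈ convexDomains D) {K : Set (E D)}
    (hK : IsCompact K) (hKne : K.Nonempty) (hKΩ : K ⊆ Ω) :
    ∃ (n : ℕ) (_ : NeZero n) (ν : Fin n → E D) (c : Fin n → ℝ), (∀ i, ‖ν i‖ = 1) ∧
      K ⊆ polyhedron ν c ∧ polyhedron ν c ⊆ Ω := by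
  obtain ⟨ho, hb, hconv, hne⟩ := hΩ
  have hFc : IsCompact (frontier Ω) :=
    Metric.isCompact_of_isClosed_isBounded isClosed_frontier (hb.closure.subset frontier_subset_closure)
  have sep : ∀ z : frontier Ω, ∃ (ν : E D) (c : ℝ), ‖ν‖ = 1 ∧ (∀ x ∈ K, inner ℝ ν x < c) ∧
      c < inner ℝ ν (z : E D) := by
    rintro ⟨z, hz⟩
    have hzΩ : z ∉ Ω := fun h => by
      rw [ho.frontier_eq] at hz; exact hz.2 h
    obtain ⟨f, hf⟩ := geometric_hahn_banach_open_point hconv ho hzΩ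
    set v := (InnerProductSpace.toDual ℝ (E D)).symm f with hv
    have hfv : ∀ x, f x = inner ℝ v x := fun x => by simp [hv]
    have hv0 : v ≠ 0 := by
      rintro h0
      obtain ⟨x, hx⟩ := hne
      have := hf x hx
      simp [hfv, h0] at this
    obtain ⟨m, hmK, hmax⟩ := hK.exists_isMaxOn hKne f.continuous.continuousOn
    have hvn : 0 < ‖v‖ := norm_pos_iff.2 hv0
    refine ⟨‖v‖⁻¹ • v, ‖v‖⁻¹ * ((f m + f z) / 2), ?_, fun x hx => ?_, ?_⟩
    · rw [norm_smul, norm_inv, norm_norm, inv_mul_cancel₀ hvn.ne']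
    · rw [real_inner_smul_left, ← hfv]
      have h1 : f x ≤ f m := hmax hx
      have h2 := hf m (hKΩ hmK)
      have : f x < (f m + f z) / 2 := by linarith
      gcongr
    · rw [real_inner_smul_left, ← hfv]
      have h2 := hf m (hKΩ hmK)
      have : (f m + f z) / 2 < f z := by linarith
      gcongr
  choose ν c hν hKc hz using sep
  obtain ⟨t, ht⟩ := hFc.elim_finite_subcover
    (fun z : frontier Ω => {x : E D | c z < inner ℝ (ν z) x})
    (fun z => isOpen_lt continuous_const (continuous_const.inner continuous_id))
    (fun z hz' => Set.mem_iUnion.2 ⟨⟨z, hz'⟩, hz ⟨z, hz'⟩⟩)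
  have htne : t.Nonempty := by
    rw [Finset.nonempty_iff_ne_empty]
    rintro rfl
    have hfe : frontier Ω = ∅ := by simpa using ht
    have huniv : Ω = Set.univ := by
      rcases (isClopen_iff_frontier_eq_empty.2 hfe).eq_univ hne with h
      exact h
    have : Nonempty (Fin D) := ⟨⟨0, hD⟩⟩
    rw [huniv] at hb
    exact NoncompactSpace.noncompact_univ (X := E D)
      (Metric.isCompact_of_isClosed_isBounded isClosed_univ hb)
  set e := t.equivFin
  refine ⟨t.card, ⟨htne.card_pos.ne'⟩, fun i => ν (e.symm i), fun i => c (e.symm i),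
    fun i => hν _, fun x hx i => hKc _ x hx, ?_⟩
  set P := polyhedron (fun i => ν (e.symm i)) (fun i => c (e.symm i)) with hP
  have hPconv : Convex ℝ P := by
    simp only [hP, polyhedron, Set.ofPred_forall]
    refine convex_iInter fun i => ?_
    exact convex_halfSpace_lt (innerSL ℝ (ν (e.symm i))).isLinear _
  have hdisj : Disjoint P (frontier Ω) := by
    refine Set.disjoint_left.2 fun x hxP hxF => ?_
    obtain ⟨z, hz'⟩ := Set.mem_iUnion.1 (ht hxF)
    obtain ⟨hzt, hxz⟩ := Set.mem_iUnion.1 hz'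
    have := hxP (e ⟨z, hzt⟩)
    simp only [Equiv.symm_apply_apply] at this
    exact lt_asymm this hxz
  obtain ⟨k, hk⟩ := hKne
  have hkP : k ∈ P := fun i => hKc _ k hk
  by_contra hnot
  obtain ⟨y, hyP, hyΩ⟩ := Set.not_subset.1 hnot
  have hcl : ∀ x ∈ P, x ∉ Ω → x ∉ closure Ω := fun x hxP hx hxc =>
    Set.disjoint_left.1 hdisj hxP (by rw [ho.frontier_eq]; exact ⟨hxc, hx⟩)
  obtain ⟨x, -, hx, hxc⟩ := hPconv.isPreconnected Ω (closure Ω)ᶜ ho isClosed_closure.isOpen_compl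
    (fun x hx => or_iff_not_imp_left.2 (hcl x hx)) ⟨k, hkP, hKΩ hk⟩ ⟨y, hyP, hcl y hyP hyΩ⟩
  exact hxc (subset_closure hx)

lemma bddAbove_inradius (hD : 1 ≤ D) (hb : Bornology.IsBounded Ω) :
    BddAbove {r : ℝ | 0 < r ∧ ∃ x, Metric.ball x r ⊆ Ω} := by
  have : Nonempty (Fin D) := ⟨⟨0, hD⟩⟩
  refine ⟨Metric.diam Ω, ?_⟩
  rintro r ⟨hr, x, hx⟩
  have h1 := Metric.diam_mono hx hb
  rw [Metric.diam_ball_eq x hr.le] at h1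
  linarith

lemma le_inradius (hD : 1 ≤ D) (hb : Bornology.IsBounded Ω) {x : E D} {r : ℝ} (hr : 0 < r)
    (h : Metric.ball x r ⊆ Ω) : r ≤ inradius Ω :=
  le_csSup (bddAbove_inradius hD hb) ⟨hr, x, h⟩

lemma inradius_pos (hD : 1 ≤ D) (hΩ : Ω ∈ convexDomains D) : 0 < inradius Ω := by
  obtain ⟨x, hx⟩ := hΩ.2.2.2
  obtain ⟨r, hr, h⟩ := Metric.isOpen_iff.1 hΩ.1 x hx
  exact hr.trans_le (le_inradius hD hΩ.2.1 hr h)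

/-- Makai's inequality. -/
theorem energy_le_makai (hD : 1 ≤ D) (hpq : p.HolderConjugate q) (hΩ : Ω ∈ convexDomains D)
    (h : IsTestFunction Ω φ) :
    energy p φ ≤ inradius Ω ^ q / (q * (q + 1)) * volume.real Ω := by
  have hq0 := hpq.symm.pos
  have hRpos := inradius_pos hD hΩ
  rcases (tsupport φ).eq_empty_or_nonempty with he | hne
  · have h0 : φ = 0 := tsupport_eq_empty_iff.1 he
    have : energy p φ = 0 := by
      have hg : gradient (0 : E D → ℝ) = 0 := by
        funext x; simp [gradient]
      simp [energy, h0, hg, Real.zero_rpow hpq.pos.ne']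
    rw [this]
    positivity
  · obtain ⟨n, hn, ν, c, hν, hKP, hPΩ⟩ := exists_polyhedron_between hD hΩ h.2.1 hne h.2.2
    refine (energy_le_of_polyhedron hpq hν
      (fun x r hr hx => le_inradius hD hΩ.2.1 hr (hx.trans hPΩ)) (hΩ.2.1.subset hPΩ)
      ⟨h.1, h.2.1, hKP⟩).trans ?_
    exact mul_le_mul_of_nonneg_left (measureReal_mono hPΩ hΩ.2.1.measure_lt_top.ne) (by positivity)

section Lp

variable {α F : Type*} [MeasurableSpace α] {μ : Measure α} [NormedAddCommGroup F]

lemma fact_one_le_ofReal (hp : 1 ≤ p) : Fact (1 ≤ ENNReal.ofReal p) :=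
  ⟨by simpa using ENNReal.ofReal_le_ofReal hp⟩

lemma norm_toLp_rpow (hp : 1 ≤ p) {f : α → F} (hf : MemLp f (ENNReal.ofReal p) μ) :
    ‖hf.toLp f‖ ^ p = ∫ x, ‖f x‖ ^ p ∂μ := by
  have hp0 : 0 < p := by linarith
  have hnn : 0 ≤ ∫ x, ‖f x‖ ^ p ∂μ := integral_nonneg fun x => by positivity
  rw [Lp.norm_toLp, hf.eLpNorm_eq_integral_rpow_norm (by simpa using hp0) (by simp),
    ENNReal.toReal_ofReal hp0.le, ENNReal.toReal_ofReal (by positivity), ← Real.rpow_mul hnn,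
    inv_mul_cancel₀ hp0.ne', Real.rpow_one]

lemma integrable_norm_rpow_of_memLp (hp : 1 ≤ p) {f : α → F} (hf : MemLp f (ENNReal.ofReal p) μ) :
    Integrable (fun x => ‖f x‖ ^ p) μ := by
  have hp0 : 0 < p := by linarith
  simpa [ENNReal.toReal_ofReal hp0.le] using
    hf.integrable_norm_rpow (by simpa using hp0) (by simp)

lemma tendsto_integral_norm_rpow (hp : 1 ≤ p) {f : ℕ → α → F} {g : α → F}
    (hf : ∀ n, MemLp (f n) (ENNReal.ofReal p) μ) (hg : MemLp g (ENNReal.ofReal p) μ)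
    (h : Tendsto (fun n => eLpNorm (fun x => g x - f n x) (ENNReal.ofReal p) μ) atTop (𝓝 0)) :
    Tendsto (fun n => ∫ x, ‖f n x‖ ^ p ∂μ) atTop (𝓝 (∫ x, ‖g x‖ ^ p ∂μ)) := by
  have := fact_one_le_ofReal hp
  have h' : Tendsto (fun n => (hf n).toLp (f n)) atTop (𝓝 (hg.toLp g)) := by
    refine (Lp.tendsto_Lp_iff_tendsto_eLpNorm'' f hf g hg).2 ?_
    refine h.congr fun n => ?_
    exact eLpNorm_sub_comm g (f n) _ _
  have h2 := (h'.norm).rpow_const (p := p) (Or.inr (by linarith))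
  simpa only [norm_toLp_rpow hp] using h2

lemma exists_lp_limit [CompleteSpace F] (hp : 1 ≤ p) {f : ℕ → α → F}
    (hf : ∀ n, MemLp (f n) (ENNReal.ofReal p) μ)
    (h : ∀ ε > 0, ∃ N, ∀ m ≥ N, ∀ n ≥ N, ∫ x, ‖f m x - f n x‖ ^ p ∂μ < ε) :
    ∃ g : α → F, MemLp g (ENNReal.ofReal p) μ ∧
      Tendsto (fun n => eLpNorm (fun x => g x - f n x) (ENNReal.ofReal p) μ) atTop (𝓝 0) := by
  have := fact_one_le_ofReal hp
  have hp0 : 0 < p := by linarith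
  have hc : CauchySeq fun n => (hf n).toLp (f n) := by
    refine Metric.cauchySeq_iff.2 fun ε hε => ?_
    obtain ⟨N, hN⟩ := h (ε ^ p) (by positivity)
    refine ⟨N, fun m hm n hn => ?_⟩
    rw [dist_eq_norm, ← MemLp.toLp_sub]
    have h1 := norm_toLp_rpow hp ((hf m).sub (hf n))
    have h2 := hN m hm n hn
    refine (Real.rpow_lt_rpow_iff (norm_nonneg _) hε.le hp0).1 ?_
    rw [h1]
    exact h2
  obtain ⟨g, hg⟩ := cauchySeq_tendsto_of_complete hc
  refine ⟨g, Lp.memLp g, ?_⟩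
  rw [← Lp.toLp_coeFn g (Lp.memLp g), Lp.tendsto_Lp_iff_tendsto_eLpNorm'' f hf] at hg
  refine hg.congr fun n => ?_
  exact eLpNorm_sub_comm (f n) g _ _

lemma tendsto_integral_bilin {G H : Type*} [NormedAddCommGroup G] [NormedAddCommGroup H]
    [NormedSpace ℝ F] [NormedSpace ℝ G] [NormedSpace ℝ H]
    (hpq : p.HolderConjugate q) (B : F →L[ℝ] G →L[ℝ] H) {f : ℕ → α → F} {g : α → F} {k : α → G}
    (hf : ∀ n, MemLp (f n) (ENNReal.ofReal p) μ) (hg : MemLp g (ENNReal.ofReal p) μ)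
    (hk : MemLp k (ENNReal.ofReal q) μ)
    (h : Tendsto (fun n => eLpNorm (fun x => g x - f n x) (ENNReal.ofReal p) μ) atTop (𝓝 0)) :
    Tendsto (fun n => ∫ x, B (f n x) (k x) ∂μ) atTop (𝓝 (∫ x, B (g x) (k x) ∂μ)) := by
  have := hpq.ennrealOfReal
  have hle : ∀ u : α → F, ∀ᵐ x ∂μ, ‖B (u x) (k x)‖ ≤ ‖B‖₊ * ‖u x‖ * ‖k x‖ := fun u =>
    ae_of_all _ fun x => B.le_opNorm₂ _ _
  have hI : ∀ {u : α → F}, MemLp u (ENNReal.ofReal p) μ → Integrable (fun x => B (u x) (k x)) μ :=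
    fun {u} hu => memLp_one_iff_integrable.1
      (MemLp.of_bilin (r := 1) (fun a b => B a b) ‖B‖₊ hu hk
        (B.aestronglyMeasurable_comp₂ hu.1 hk.1) (hle u))
  refine tendsto_integral_of_L1' _ (hI hg).1 (Eventually.of_forall fun n => hI (hf n)) ?_
  have hbound : ∀ n, eLpNorm ((fun x => B (f n x) (k x)) - fun x => B (g x) (k x)) 1 μ ≤
      ‖B‖₊ * eLpNorm (fun x => g x - f n x) (ENNReal.ofReal p) μ * eLpNorm k (ENNReal.ofReal q) μ := by
    intro n
    have h1 := eLpNorm_le_eLpNorm_mul_eLpNorm'_of_norm (p := ENNReal.ofReal p)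
      (q := ENNReal.ofReal q) (r := 1) (hg.sub (hf n)).1 hk.1
      (fun a b => B a b) ‖B‖₊ (hle (g - f n))
    rw [eLpNorm_sub_comm]
    refine le_trans (le_of_eq ?_) h1
    congr 1 with x
    simp
  refine tendsto_of_tendsto_of_tendsto_of_le_of_le tendsto_const_nhds ?_ (fun _ => zero_le) hbound
  have hz := ENNReal.Tendsto.mul_const (ENNReal.Tendsto.const_mul (a := (‖B‖₊ : ENNReal)) h
    (Or.inr (by simp))) (b := eLpNorm k (ENNReal.ofReal q) μ) (Or.inr hk.2.ne)
  simpa using hz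

end Lp

/-- One-dimensional Poincaré inequality. -/
lemma intervalIntegral_poincare (hp : 1 < p) {f g : ℝ → ℝ} {a b : ℝ} (hab : a ≤ b)
    (hf : ∀ t, HasDerivAt f (g t) t) (hg : Continuous g) (ha : f a = 0) :
    ∫ t in a..b, |f t| ^ p ≤ (b - a) ^ p * ∫ t in a..b, |g t| ^ p := by
  have hpq := Real.HolderConjugate.conjExponent hp
  set q := p.conjExponent
  have hp0 : 0 < p := by linarith
  have h0 : 0 ≤ b - a := sub_nonneg.2 hab
  have hfc : Continuous f := continuous_iff_continuousAt.2 fun t => (hf t).continuousAt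
  have cgp : Continuous fun t => |g t| ^ p := hg.abs.rpow_const fun _ => Or.inr hp0.le
  set I := ∫ t in a..b, |g t| ^ p with hI
  have hI0 : 0 ≤ I := intervalIntegral.integral_nonneg hab fun t _ => by positivity
  have hold : ∫ t in a..b, |g t| ≤ I ^ (1 / p) * (b - a) ^ (1 / q) := by
    have := integral_mul_le_Lp_mul_Lq_of_nonneg (μ := volume.restrict (Set.Ioc a b)) hpq
      (f := fun t => |g t|) (g := fun _ => 1) (ae_of_all _ fun t => abs_nonneg _)
      (ae_of_all _ fun t => zero_le_one)
      ((memLp_top_of_bound hg.abs.aestronglyMeasurable (sSup ((fun t => |g t|) '' Set.Icc a b)) ?_).mono_exponent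
        le_top) (memLp_const 1)
    · simp only [mul_one, Real.one_rpow] at this
      rw [← intervalIntegral.integral_of_le hab, ← intervalIntegral.integral_of_le hab] at this
      simpa [abs_of_nonneg h0, Measure.real, h0] using this
    · refine (ae_restrict_iff' measurableSet_Ioc).2 (ae_of_all _ fun t ht => ?_)
      rw [Real.norm_of_nonneg (abs_nonneg _)]
      exact le_csSup (isCompact_Icc.image hg.abs).bddAbove ⟨t, Set.Ioc_subset_Icc_self ht, rfl⟩
  have hpt : ∀ t ∈ Set.Icc a b, |f t| ^ p ≤ I * (b - a) ^ (p / q) := by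
    intro t ht
    have h1 : f t = ∫ s in a..t, g s := by
      rw [intervalIntegral.integral_eq_sub_of_hasDerivAt (fun s _ => hf s)
        (hg.intervalIntegrable _ _), ha, sub_zero]
    have h2 : |f t| ≤ ∫ s in a..b, |g s| := by
      rw [h1]
      refine (intervalIntegral.abs_integral_le_integral_abs ht.1).trans ?_
      exact intervalIntegral.integral_mono_interval le_rfl ht.1 ht.2
        (ae_of_all _ fun s => abs_nonneg _) (hg.abs.intervalIntegrable _ _)
    have h3 := Real.rpow_le_rpow (abs_nonneg _) (h2.trans hold) hp0.le
    rwa [Real.mul_rpow (by positivity) (by positivity), ← Real.rpow_mul hI0, ← Real.rpow_mul h0,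
      one_div_mul_cancel hp0.ne', Real.rpow_one, one_div_mul_eq_div] at h3
  have h4 := intervalIntegral.integral_mono_on hab
    ((hfc.abs.rpow_const fun _ => Or.inr hp0.le).intervalIntegrable a b)
    (intervalIntegrable_const (μ := volume)) hpt
  rw [intervalIntegral.integral_const, smul_eq_mul] at h4
  refine h4.trans (le_of_eq ?_)
  have h5 : p / q = p - 1 := hpq.div_conj_eq_sub_one
  have h6 : (b - a) ^ p = (b - a) * (b - a) ^ (p / q) := by
    rw [h5, mul_comm, ← Real.rpow_add_one' h0 (by linarith), sub_add_cancel]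
  rw [h6]; ring

/-- The Poincaré inequality for test functions of a bounded set. -/
lemma exists_poincare (hD : 1 ≤ D) (hp : 1 < p) (hb : Bornology.IsBounded Ω) :
    ∃ C : ℝ, 0 < C ∧ ∀ φ : E D → ℝ, IsTestFunction Ω φ →
      ∫ x, ‖φ x‖ ^ p ≤ C * ∫ x, ‖gradient φ x‖ ^ p := by
  have hp0 : 0 < p := by linarith
  obtain ⟨M, hM, hMΩ⟩ := hb.subset_ball_lt 0 0
  refine ⟨(2 * M) ^ p, by positivity, fun φ h => ?_⟩
  set ν : E D := EuclideanSpace.single ⟨0, hD⟩ 1 with hνdef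
  have hν : ‖ν‖ = 1 := by simp [hνdef]
  set F : E D → ℝ := fun x => ‖φ x‖ ^ p - (2 * M) ^ p * ‖gradient φ x‖ ^ p with hF
  have cφ : Continuous fun x => ‖φ x‖ ^ p := h.continuous.norm.rpow_const fun _ => Or.inr hp0.le
  have cg := h.continuous_norm_gradient_rpow hp0.le
  have cF : Continuous F := cφ.sub (continuous_const.mul cg)
  have i1 := h.integrable_norm_rpow hp0
  have i2 := (h.integrable_norm_gradient_rpow hp0).const_mul ((2 * M) ^ p)
  have := integral_nonpos_of_line_integral_nonpos cF.measurable (i1.sub i2) hν fun x => ?_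
  · simp only [hF] at this
    rw [integral_sub i1 i2, integral_const_mul] at this
    linarith
  set a := -inner ℝ ν x - M with ha
  set b := -inner ℝ ν x + M with hb'
  have hin : ∀ t, inner ℝ ν (x + t • ν) = inner ℝ ν x + t := inner_add_smul_self hν x
  have hout : ∀ t : ℝ, (t ≤ a ∨ b ≤ t) → x + t • ν ∉ Ω := by
    intro t ht hm
    have h1 := mem_ball_zero_iff.1 (hMΩ hm)
    have h2 := abs_le.1 ((abs_real_inner_le_norm ν (x + t • ν)).trans (by rw [hν, one_mul]))
    rw [hin] at h2
    rcases ht with ht | ht <;> linarith [h2.1, h2.2]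
  have hab : a ≤ b := by linarith
  have e : ∫ t : ℝ, F (x + t • ν) = ∫ t in a..b, F (x + t • ν) := by
    rw [intervalIntegral.integral_of_le hab]
    refine (setIntegral_eq_integral_of_forall_compl_eq_zero fun t ht => ?_).symm
    have : x + t • ν ∉ Ω := hout t (by
      by_contra! hc
      exact ht ⟨hc.1, hc.2.le⟩)
    simp [hF, h.eq_zero this, h.gradient_eq_zero this, Real.zero_rpow hp0.ne']
  rw [e]
  have cl : Continuous fun t : ℝ => x + t • ν := by fun_prop
  have cg' : Continuous fun t : ℝ => inner ℝ (gradient φ (x + t • ν)) ν :=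
    (h.continuous_gradient.comp cl).inner continuous_const
  have h1 := intervalIntegral_poincare hp hab (fun t => h.hasDerivAt_line x ν t) cg'
    (h.eq_zero (hout a (Or.inl le_rfl)))
  have hba : b - a = 2 * M := by rw [ha, hb']; ring
  rw [hba] at h1
  have h2 : ∫ t in a..b, |inner ℝ (gradient φ (x + t • ν)) ν| ^ p ≤
      ∫ t in a..b, ‖gradient φ (x + t • ν)‖ ^ p := by
    refine intervalIntegral.integral_mono_on hab
      ((cg'.abs.rpow_const fun _ => Or.inr hp0.le).intervalIntegrable _ _)
      ((cg.comp cl).intervalIntegrable _ _) fun t _ => ?_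
    refine Real.rpow_le_rpow (abs_nonneg _) ?_ hp0.le
    simpa [hν] using abs_real_inner_le_norm (gradient φ (x + t • ν)) ν
  simp only [hF]
  have j1 : IntervalIntegrable (fun t : ℝ => ‖φ (x + t • ν)‖ ^ p) volume a b :=
    (cφ.comp cl).intervalIntegrable _ _
  have j2 : IntervalIntegrable (fun t : ℝ => (2 * M) ^ p * ‖gradient φ (x + t • ν)‖ ^ p)
      volume a b := (continuous_const.mul (cg.comp cl)).intervalIntegrable _ _
  rw [intervalIntegral.integral_sub j1 j2, intervalIntegral.integral_const_mul]
  have h3 := mul_le_mul_of_nonneg_left h2 (by positivity : 0 ≤ (2 * M) ^ p)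
  simp only [Real.norm_eq_abs] at h1 ⊢
  linarith

/-- The values of the energy on the test functions of `Ω`. -/
def energies (p : ℝ) (Ω : Set (E D)) : Set ℝ := energy p '' {φ | IsTestFunction Ω φ}

lemma energy_zero (hp : 0 < p) : energy p (0 : E D → ℝ) = 0 := by
  have hg : gradient (0 : E D → ℝ) = 0 := by
    funext x; simp [gradient]
  simp [energy, hg, Real.zero_rpow hp.ne']

lemma energies_nonempty (p : ℝ) (Ω : Set (E D)) : (energies p Ω).Nonempty :=
  ⟨_, 0, IsTestFunction.zero Ω, rfl⟩

lemma bddAbove_energies (hD : 1 ≤ D) (hpq : p.HolderConjugate q) (hΩ : Ω ∈ convexDomains D) :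
    BddAbove (energies p Ω) := by
  refine ⟨inradius Ω ^ q / (q * (q + 1)) * volume.real Ω, ?_⟩
  rintro _ ⟨φ, hφ, rfl⟩
  exact energy_le_makai hD hpq hΩ hφ

lemma energy_const_mul (h : IsTestFunction Ω φ) {c : ℝ} (hc : 0 ≤ c) :
    energy p (fun x => c * φ x) =
      c * (∫ x, φ x) - (1 / p) * (c ^ p * ∫ x, ‖gradient φ x‖ ^ p) := by
  unfold energy
  simp only [h.gradient_const_mul, norm_smul, Real.norm_of_nonneg hc,
    Real.mul_rpow hc (norm_nonneg _), integral_const_mul]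

/-- Near-maximisers of the energy have bounded gradients in `L^p`. -/
lemma integral_norm_gradient_rpow_le (hp : 1 < p) (hbdd : BddAbove (energies p Ω)) :
    ∃ B : ℝ, 0 < B ∧ ∀ φ, IsTestFunction Ω φ → sSup (energies p Ω) - 1 ≤ energy p φ →
      ∫ x, ‖gradient φ x‖ ^ p ≤ B := by
  have hp0 : 0 < p := by linarith
  set M := sSup (energies p Ω) with hM
  have hM0 : 0 ≤ M := le_csSup hbdd ⟨0, IsTestFunction.zero Ω, energy_zero hp0⟩
  set l : ℝ := (1 / 2) ^ (1 / (p - 1)) with hl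
  have hl0 : 0 < l := by positivity
  have hl1 : l ≤ 1 := Real.rpow_le_one (by norm_num) (by norm_num)
    (one_div_nonneg.2 (by linarith))
  have hlp : l ^ p = l * (1 / 2) := by
    have h1 : l ^ (p - 1) = 1 / 2 := by
      rw [hl, ← Real.rpow_mul (by norm_num), one_div_mul_cancel (by linarith), Real.rpow_one]
    rw [← h1, mul_comm, ← Real.rpow_add_one' hl0.le (by linarith), sub_add_cancel]
  have hMl : M ≤ M / l := by
    rw [le_div_iff₀ hl0]
    exact mul_le_of_le_one_right hM0 hl1
  refine ⟨2 * p * (M / l - M + 1), by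
    have : 0 < M / l - M + 1 := by linarith
    positivity, fun φ h hφ => ?_⟩
  set A := ∫ x, ‖gradient φ x‖ ^ p with hA
  have h1 : energy p (fun x => l * φ x) ≤ M := le_csSup hbdd ⟨_, h.const_mul l, rfl⟩
  rw [energy_const_mul h hl0.le, hlp, ← hA] at h1
  have h2 : M - 1 ≤ (∫ x, φ x) - (1 / p) * A := hφ
  have h3 : (∫ x, φ x) - (1 / p) * (A / 2) ≤ M / l := by
    rw [le_div_iff₀ hl0]
    linarith
  have h4 : (1 / p) * (A / 2) ≤ M / l - M + 1 := by linarith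
  have h5 : 2 * p * ((1 / p) * (A / 2)) = A := by field_simp
  rw [← h5]
  gcongr

lemma integral_norm_gradient_sub_rpow_le (hp : 1 < p) (hbdd : BddAbove (energies p Ω)) {ε K δ : ℝ}
    (hK : 0 ≤ K)
    (hKε : ∀ a b : E D, ‖a - b‖ ^ p ≤ ε * (‖a‖ ^ p + ‖b‖ ^ p) +
      K * ((‖a‖ ^ p + ‖b‖ ^ p) / 2 - ‖(1 / 2 : ℝ) • (a + b)‖ ^ p))
    (h : IsTestFunction Ω φ) (h' : IsTestFunction Ω ψ)
    (hφ : sSup (energies p Ω) - δ ≤ energy p φ) (hψ : sSup (energies p Ω) - δ ≤ energy p ψ) :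
    ∫ x, ‖gradient φ x - gradient ψ x‖ ^ p ≤
      ε * ((∫ x, ‖gradient φ x‖ ^ p) + ∫ x, ‖gradient ψ x‖ ^ p) + K * (p * δ) := by
  have hp0 : 0 < p := by linarith
  have hmid := (h.add h').const_mul (1 / 2)
  have hE : energy p (fun x => 1 / 2 * (φ x + ψ x)) ≤ sSup (energies p Ω) :=
    le_csSup hbdd ⟨_, hmid, rfl⟩
  have gmid : ∀ x, gradient (fun x => 1 / 2 * (φ x + ψ x)) x =
      (1 / 2 : ℝ) • (gradient φ x + gradient ψ x) := fun x => by
    rw [(h.add h').gradient_const_mul, h.gradient_add h']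
  have i1 := h.integrable_norm_gradient_rpow hp0
  have i2 := h'.integrable_norm_gradient_rpow hp0
  have i3 := hmid.integrable_norm_gradient_rpow hp0
  have i4 := (h.sub h').integrable_norm_gradient_rpow hp0
  simp only [gmid] at i3
  simp only [h.gradient_sub h'] at i4
  have hmono := integral_mono i4 (((i1.add i2).const_mul ε).add
    ((((i1.add i2).div_const 2).sub i3).const_mul K)) fun x => hKε (gradient φ x) (gradient ψ x)
  simp only [Pi.add_apply, Pi.sub_apply] at hmono
  have i12 : Integrable fun x => ‖gradient φ x‖ ^ p + ‖gradient ψ x‖ ^ p := i1.add i2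
  have i13 : Integrable fun x => (‖gradient φ x‖ ^ p + ‖gradient ψ x‖ ^ p) / 2 -
      ‖(1 / 2 : ℝ) • (gradient φ x + gradient ψ x)‖ ^ p := (i12.div_const 2).sub i3
  rw [integral_add (i12.const_mul ε) (i13.const_mul K),
    integral_const_mul, integral_const_mul, integral_sub (i12.div_const 2) i3,
    integral_div, integral_add i1 i2] at hmono
  unfold energy at hφ hψ hE
  simp only [gmid] at hE
  rw [integral_const_mul, integral_add h.integrable h'.integrable] at hE
  refine hmono.trans ?_
  gcongr
  have key : (1 / p) * (((∫ x, ‖gradient φ x‖ ^ p) + ∫ x, ‖gradient ψ x‖ ^ p) / 2 -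
      ∫ x, ‖(1 / 2 : ℝ) • (gradient φ x + gradient ψ x)‖ ^ p) ≤ δ := by linarith
  rw [one_div, inv_mul_le_iff₀ hp0] at key
  exact key

/-- The energy attains its supremum in `W_0^{1,p}`. -/
lemma exists_maximizer (hD : 1 ≤ D) (hp : 1 < p) (hΩ : Ω ∈ convexDomains D) :
    ∃ (φ : ℕ → E D → ℝ) (u : E D → ℝ) (G : E D → E D), (∀ n, IsTestFunction Ω (φ n)) ∧
      MemLp u (ENNReal.ofReal p) (volume.restrict Ω) ∧
      MemLp G (ENNReal.ofReal p) (volume.restrict Ω) ∧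
      Tendsto (fun n => eLpNorm (fun x => u x - φ n x) (ENNReal.ofReal p) (volume.restrict Ω))
        atTop (𝓝 0) ∧
      Tendsto (fun n => eLpNorm (fun x => G x - gradient (φ n) x) (ENNReal.ofReal p)
        (volume.restrict Ω)) atTop (𝓝 0) ∧
      Tendsto (fun n => energy p (φ n)) atTop (𝓝 (sSup (energies p Ω))) := by
  have hp0 : 0 < p := by linarith
  have hbdd := bddAbove_energies hD (Real.HolderConjugate.conjExponent hp) hΩ
  set M := sSup (energies p Ω) with hM
  have hex : ∀ n : ℕ, ∃ φ, IsTestFunction Ω φ ∧ M - 1 / ((n : ℝ) + 1) < energy p φ := by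
    intro n
    obtain ⟨_, ⟨φ, hφ, rfl⟩, hlt⟩ := exists_lt_of_lt_csSup (energies_nonempty p Ω)
      (show M - 1 / ((n : ℝ) + 1) < sSup (energies p Ω) from
        sub_lt_self _ Nat.one_div_pos_of_nat)
    exact ⟨φ, hφ, hlt⟩
  choose φ hφ hE using hex
  have hEM : ∀ n, energy p (φ n) ≤ M := fun n => le_csSup hbdd ⟨_, hφ n, rfl⟩
  have hlim : Tendsto (fun n => energy p (φ n)) atTop (𝓝 M) := by
    refine tendsto_of_tendsto_of_tendsto_of_le_of_le ?_ tendsto_const_nhds (fun n => (hE n).le) hEM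
    simpa using tendsto_const_nhds.sub (tendsto_one_div_add_atTop_nhds_zero_nat (𝕜 := ℝ))
  obtain ⟨B, hB, hBφ⟩ := integral_norm_gradient_rpow_le hp hbdd
  have hA : ∀ n, ∫ x, ‖gradient (φ n) x‖ ^ p ≤ B := fun n => hBφ _ (hφ n) (by
    have : 1 / ((n : ℝ) + 1) ≤ 1 := by
      rw [div_le_one (by positivity)]; linarith [(n.cast_nonneg : (0 : ℝ) ≤ n)]
    linarith [hE n])
  have hcauchy : ∀ ε > 0, ∃ N, ∀ m ≥ N, ∀ n ≥ N,
      ∫ x, ‖gradient (φ m) x - gradient (φ n) x‖ ^ p < ε := by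
    intro ε hε
    obtain ⟨K, hK, hKε⟩ := norm_sub_rpow_le_of_midpoint (D := D) hp
      (show 0 < ε / (4 * B) by positivity)
    set δ := ε / (4 * (K * p + 1)) with hδ
    have hδ0 : 0 < δ := by positivity
    obtain ⟨N, hN⟩ := eventually_atTop.1 (hlim.eventually (lt_mem_nhds (sub_lt_self M hδ0)))
    refine ⟨N, fun m hm n hn => ?_⟩
    refine (integral_norm_gradient_sub_rpow_le hp hbdd hK hKε (hφ m) (hφ n) (hN m hm).le
      (hN n hn).le).trans_lt ?_
    have h1 : ε / (4 * B) * ((∫ x, ‖gradient (φ m) x‖ ^ p) + ∫ x, ‖gradient (φ n) x‖ ^ p) ≤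
        ε / (4 * B) * (B + B) := by
      gcongr
      · exact hA m
      · exact hA n
    have h2 : ε / (4 * B) * (B + B) = ε / 2 := by field_simp; ring
    have h3 : K * (p * δ) ≤ ε / 4 := by
      have : δ * (K * p + 1) = ε / 4 := by rw [hδ]; field_simp
      nlinarith
    linarith
  obtain ⟨C, hC, hCφ⟩ := exists_poincare hD hp hΩ.2.1
  obtain ⟨u, hu, hulim⟩ := exists_lp_limit (μ := volume.restrict Ω) hp.le
    (fun n => (hφ n).memLp (ENNReal.ofReal p) _) (fun ε hε => by
      obtain ⟨N, hN⟩ := hcauchy (ε / C) (by positivity)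
      refine ⟨N, fun m hm n hn => ?_⟩
      have ht := (hφ m).sub (hφ n)
      rw [ht.setIntegral_norm_rpow_eq hp0]
      have h1 := hCφ _ ht
      simp only [(hφ m).gradient_sub (hφ n)] at h1
      refine h1.trans_lt ?_
      have := hN m hm n hn
      rwa [lt_div_iff₀' hC] at this)
  obtain ⟨G, hG, hGlim⟩ := exists_lp_limit (μ := volume.restrict Ω) hp.le
    (fun n => (hφ n).memLp_gradient (ENNReal.ofReal p) _) (fun ε hε => by
      obtain ⟨N, hN⟩ := hcauchy ε hε
      refine ⟨N, fun m hm n hn => ?_⟩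
      have ht := ((hφ m).sub (hφ n)).setIntegral_norm_gradient_rpow_eq hp0
      simp only [(hφ m).gradient_sub (hφ n)] at ht
      rw [ht]
      exact hN m hm n hn)
  exact ⟨φ, u, G, hφ, hu, hG, hulim, hGlim, hlim⟩

lemma tendsto_setIntegral_of_tendsto_eLpNorm (hpq : p.HolderConjugate q)
    (hb : Bornology.IsBounded Ω) {f : ℕ → E D → ℝ} {u : E D → ℝ}
    (hf : ∀ n, MemLp (f n) (ENNReal.ofReal p) (volume.restrict Ω))
    (hu : MemLp u (ENNReal.ofReal p) (volume.restrict Ω))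
    (h : Tendsto (fun n => eLpNorm (fun x => u x - f n x) (ENNReal.ofReal p) (volume.restrict Ω))
        atTop (𝓝 0)) :
    Tendsto (fun n => ∫ x in Ω, f n x) atTop (𝓝 (∫ x in Ω, u x)) := by
  have : IsFiniteMeasure (volume.restrict Ω) := ⟨by simpa using hb.measure_lt_top⟩
  simpa using tendsto_integral_bilin hpq (ContinuousLinearMap.mul ℝ ℝ) hf hu
    (memLp_const (1 : ℝ)) h

lemma isSobolevZero_of_tendsto (hpq : p.HolderConjugate q) {φ : ℕ → E D → ℝ} {u : E D → ℝ}
    {G : E D → E D} (hφ : ∀ n, IsTestFunction Ω (φ n))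
    (hu : MemLp u (ENNReal.ofReal p) (volume.restrict Ω))
    (hG : MemLp G (ENNReal.ofReal p) (volume.restrict Ω))
    (hulim : Tendsto (fun n => eLpNorm (fun x => u x - φ n x) (ENNReal.ofReal p)
      (volume.restrict Ω)) atTop (𝓝 0))
    (hGlim : Tendsto (fun n => eLpNorm (fun x => G x - gradient (φ n) x) (ENNReal.ofReal p)
      (volume.restrict Ω)) atTop (𝓝 0)) :
    IsSobolevZero p Ω u G := by
  refine ⟨⟨hu, hG, fun ψ hψ => ?_⟩, φ, hφ, hulim, hGlim⟩
  have h1 := tendsto_integral_bilin hpq (ContinuousLinearMap.lsmul ℝ ℝ)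
    (fun n => (hφ n).memLp _ _) hu (hψ.memLp_gradient _ _) hulim
  have h2 := tendsto_integral_bilin hpq (ContinuousLinearMap.lsmul ℝ ℝ).flip
    (fun n => (hφ n).memLp_gradient _ _) hG (hψ.memLp _ _) hGlim
  simp only [ContinuousLinearMap.lsmul_apply, ContinuousLinearMap.flip_apply] at h1 h2
  refine tendsto_nhds_unique h1 (h2.neg.congr fun n => ?_)
  have e : ∀ {f g : E D → ℝ}, IsTestFunction Ω f →
      ∫ x in Ω, f x • gradient g x = ∫ x, f x • gradient g x := fun {f g} hf =>
    setIntegral_eq_integral_of_forall_compl_eq_zero fun x hx => by simp [hf.eq_zero hx]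
  rw [e hψ, e (hφ n), (hφ n).integral_smul_gradient hψ]

section Derivative

variable {α : Type*} [MeasurableSpace α] {μ : Measure α}

lemma norm_rpow_sub_two_mul (hp : 1 < p) (v : E D) : ‖v‖ ^ (p - 2) * ‖v‖ = ‖v‖ ^ (p - 1) := by
  rw [← Real.rpow_add_one' (norm_nonneg _) (by linarith)]
  congr 1; ring

lemma hasDerivAt_integral_norm_rpow (hp : 1 < p) {G V : α → E D}
    (hG : MemLp G (ENNReal.ofReal p) μ) (hV : MemLp V (ENNReal.ofReal p) μ) :
    HasDerivAt (fun t : ℝ => ∫ x, ‖G x + t • V x‖ ^ p ∂μ)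
      (∫ x, p * inner ℝ (‖G x‖ ^ (p - 2) • G x) (V x) ∂μ) 0 := by
  have hp0 : 0 < p := by linarith
  set F' : ℝ → α → ℝ := fun t x =>
    p * (‖G x + t • V x‖ ^ (p - 2) * inner ℝ (G x + t • V x) (V x)) with hF'
  have hmeas : ∀ t : ℝ, AEStronglyMeasurable (fun x => G x + t • V x) μ := fun t =>
    hG.1.add (hV.1.const_smul t)
  have hmain := (hasDerivAt_integral_of_dominated_loc_of_deriv_le (μ := μ) (x₀ := (0 : ℝ))
    (F := fun t x => ‖G x + t • V x‖ ^ p) (F' := F') (s := Metric.ball 0 1)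
    (bound := fun x => p * (‖G x‖ + ‖V x‖) ^ p) (Metric.ball_mem_nhds 0 one_pos)
    (Eventually.of_forall fun t =>
      (Real.continuous_rpow_const hp0.le).comp_aestronglyMeasurable (hmeas t).norm)
    ?_ ?_ ?_ ?_ ?_).2
  · refine hmain.congr_deriv ?_
    simp only [hF', zero_smul, add_zero, real_inner_smul_left]
  · simpa using integrable_norm_rpow_of_memLp hp.le hG
  · simp only [hF']
    refine AEMeasurable.aestronglyMeasurable ?_
    exact (((hmeas 0).norm.aemeasurable.pow_const _).mul
      ((hmeas 0).inner hV.1).aemeasurable).const_mul p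
  · refine ae_of_all _ fun x t ht => ?_
    have ht1 : |t| ≤ 1 := by simpa using (mem_ball_zero_iff.1 ht).le
    simp only [hF']
    have hn : ‖G x + t • V x‖ ≤ ‖G x‖ + ‖V x‖ := by
      refine (norm_add_le _ _).trans ?_
      rw [norm_smul]
      gcongr
      exact mul_le_of_le_one_left (norm_nonneg _) ht1
    rw [norm_mul, Real.norm_of_nonneg hp0.le, norm_mul, Real.norm_of_nonneg (by positivity)]
    gcongr
    calc ‖G x + t • V x‖ ^ (p - 2) * ‖inner ℝ (G x + t • V x) (V x)‖
        ≤ ‖G x + t • V x‖ ^ (p - 2) * (‖G x + t • V x‖ * ‖V x‖) := by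
          gcongr; exact norm_inner_le_norm _ _
      _ = ‖G x + t • V x‖ ^ (p - 1) * ‖V x‖ := by
          rw [← mul_assoc, norm_rpow_sub_two_mul hp]
      _ ≤ (‖G x‖ + ‖V x‖) ^ (p - 1) * (‖G x‖ + ‖V x‖) := by
          gcongr
          linarith [norm_nonneg (G x)]
      _ = (‖G x‖ + ‖V x‖) ^ p := by
          rw [← Real.rpow_add_one' (by positivity) (by linarith), sub_add_cancel]
  · have hs : MemLp (fun x => ‖G x‖ + ‖V x‖) (ENNReal.ofReal p) μ := hG.norm.add hV.norm
    have := (integrable_norm_rpow_of_memLp hp.le hs).const_mul p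
    refine this.congr (ae_of_all _ fun x => ?_)
    simp only
    rw [Real.norm_of_nonneg (by positivity)]
  · refine ae_of_all _ fun x t _ => ?_
    have h1 : HasDerivAt (fun t : ℝ => G x + t • V x) (V x) t := by
      simpa using ((hasDerivAt_id t).smul_const (V x)).const_add (G x)
    have h2 := (hasFDerivAt_norm_rpow (G x + t • V x) hp).comp_hasDerivAt t h1
    refine h2.congr_deriv ?_
    simp only [hF', smul_apply, innerSL_apply_apply, smul_eq_mul, mul_assoc]

end Derivative

theorem exists_isTorsionFunction (hD : 1 ≤ D) (hp : 1 < p) (hΩ : Ω ∈ convexDomains D) :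
    ∃ u, IsTorsionFunction p Ω u := by
  have hp0 : 0 < p := by linarith
  have hpq := Real.HolderConjugate.conjExponent hp
  have hbdd := bddAbove_energies hD hpq hΩ
  obtain ⟨φ, u, G, hφ, hu, hG, hulim, hGlim, hlim⟩ := exists_maximizer hD hp hΩ
  refine ⟨u, G, isSobolevZero_of_tendsto hpq hφ hu hG hulim hGlim, fun ψ hψ => ?_⟩
  have hI := tendsto_setIntegral_of_tendsto_eLpNorm hpq hΩ.2.1 (fun n => (hφ n).memLp _ _) hu hulim
  have hVlp : MemLp (gradient ψ) (ENNReal.ofReal p) (volume.restrict Ω) := hψ.memLp_gradient _ _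
  have hlimt : ∀ t : ℝ, Tendsto (fun n => energy p (fun x => φ n x + t * ψ x)) atTop
      (𝓝 ((∫ x in Ω, u x) + t * (∫ x in Ω, ψ x) -
        (1 / p) * ∫ x in Ω, ‖G x + t • gradient ψ x‖ ^ p)) := by
    intro t
    have h1 := tendsto_integral_norm_rpow (μ := volume.restrict Ω) hp.le
      (f := fun n x => gradient (φ n) x + t • gradient ψ x)
      (g := fun x => G x + t • gradient ψ x)
      (fun n => ((hφ n).memLp_gradient _ _).add (hVlp.const_smul t))
      (hG.add (hVlp.const_smul t)) (by simpa using hGlim)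
    refine ((hI.add_const _).sub (h1.const_mul (1 / p))).congr fun n => ?_
    have ht := (hφ n).add (hψ.const_mul t)
    unfold energy
    rw [← ht.setIntegral_norm_gradient_rpow_eq hp0]
    congr 2
    · rw [integral_add (hφ n).integrable (hψ.const_mul t).integrable, integral_const_mul,
        (hφ n).setIntegral_eq, hψ.setIntegral_eq]
    · congr 1 with x
      rw [(hφ n).gradient_add (hψ.const_mul t), hψ.gradient_const_mul]
  have hle : ∀ t : ℝ, (∫ x in Ω, u x) + t * (∫ x in Ω, ψ x) -
        (1 / p) * ∫ x in Ω, ‖G x + t • gradient ψ x‖ ^ p ≤ sSup (energies p Ω) := fun t =>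
    le_of_tendsto' (hlimt t) fun n => le_csSup hbdd ⟨_, (hφ n).add (hψ.const_mul t), rfl⟩
  have heq : (∫ x in Ω, u x) + 0 * (∫ x in Ω, ψ x) -
        (1 / p) * ∫ x in Ω, ‖G x + (0 : ℝ) • gradient ψ x‖ ^ p = sSup (energies p Ω) :=
    tendsto_nhds_unique (hlimt 0) (by simpa using hlim)
  have hmax : IsLocalMax (fun t : ℝ => (∫ x in Ω, u x) + t * (∫ x in Ω, ψ x) -
        (1 / p) * ∫ x in Ω, ‖G x + t • gradient ψ x‖ ^ p) 0 :=
    Eventually.of_forall fun t => (hle t).trans heq.ge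
  have hder := (((hasDerivAt_id (0 : ℝ)).mul_const (∫ x in Ω, ψ x)).const_add (∫ x in Ω, u x)).sub
    ((hasDerivAt_integral_norm_rpow hp hG hVlp).const_mul (1 / p))
  have := hmax.hasDerivAt_eq_zero hder
  rw [integral_const_mul, one_mul, ← mul_assoc, one_div_mul_cancel hp0.ne', one_mul] at this
  linarith

/-- The integral of any torsion function is determined by the supremum of the energy. -/
theorem isLUB_energies_of_isTorsionFunction (hpq : p.HolderConjugate q)
    (hb : Bornology.IsBounded Ω) {u : E D → ℝ} (h : IsTorsionFunction p Ω u) :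
    IsLUB (energies p Ω) ((∫ x in Ω, u x) / q) := by
  have hp0 := hpq.pos
  have hp := hpq.lt
  obtain ⟨G, ⟨⟨hu, hG, -⟩, φ, hφ, hulim, hGlim⟩, hweak⟩ := h
  have hI := tendsto_setIntegral_of_tendsto_eLpNorm hpq hb (fun n => (hφ n).memLp _ _) hu hulim
  set σ : E D → E D := fun x => ‖G x‖ ^ (p - 2) • G x with hσ
  have hσn : ∀ x, ‖σ x‖ = ‖G x‖ ^ (p - 1) := fun x => by
    rw [hσ, norm_smul, Real.norm_of_nonneg (by positivity), norm_rpow_sub_two_mul hp]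
  have hσp : ∀ x, ‖σ x‖ ^ q = ‖G x‖ ^ p := fun x => by
    rw [hσn, ← Real.rpow_mul (norm_nonneg _), hpq.sub_one_mul_conj]
  have hσm : AEStronglyMeasurable σ (volume.restrict Ω) :=
    (hG.1.norm.aemeasurable.pow_const _).aestronglyMeasurable.smul hG.1
  have hGI := integrable_norm_rpow_of_memLp hp.le hG
  have hσLq : MemLp σ (ENNReal.ofReal q) (volume.restrict Ω) := by
    refine (integrable_norm_rpow_iff hσm (by simpa using hpq.symm.pos) (by simp)).1 ?_
    rw [ENNReal.toReal_ofReal hpq.symm.nonneg]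
    simpa only [hσp] using hGI
  have hσG : ∀ x, inner ℝ (σ x) (G x) = ‖G x‖ ^ p := fun x => by
    rw [hσ, real_inner_smul_left, real_inner_self_eq_norm_sq, pow_two, ← mul_assoc,
      norm_rpow_sub_two_mul hp, ← Real.rpow_add_one' (norm_nonneg _) (by linarith), sub_add_cancel]
  have hT : ∫ x in Ω, ‖G x‖ ^ p = ∫ x in Ω, u x := by
    have h1 := tendsto_integral_bilin hpq (innerSL ℝ (E := E D)).flip
      (fun n => (hφ n).memLp_gradient _ _) hG hσLq hGlim
    simp only [ContinuousLinearMap.flip_apply, innerSL_apply_apply] at h1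
    simp only [hσG] at h1
    refine tendsto_nhds_unique h1 (hI.congr fun n => ?_)
    exact (hweak _ (hφ n)).symm
  have hpq1 : ∀ T : ℝ, T / q = T - 1 / p * T := fun T => by
    rw [div_eq_mul_inv, ← hpq.one_sub_inv]; ring
  refine ⟨?_, fun b hbub => ?_⟩
  · rintro _ ⟨ψ, hψ, rfl⟩
    have hψI := hψ.integrable_norm_gradient_rpow hp0
    have hψΩ : IntegrableOn (fun x => ‖gradient ψ x‖ ^ p) Ω := hψI.integrableOn
    have hbI : IntegrableOn (fun x => ‖G x‖ ^ p / q + ‖gradient ψ x‖ ^ p / p) Ω :=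
      (hGI.div_const q).add (hψΩ.div_const p)
    have hpt : ∀ x, ‖inner ℝ (σ x) (gradient ψ x)‖ ≤
        ‖G x‖ ^ p / q + ‖gradient ψ x‖ ^ p / p := fun x => by
      have h1 := Real.young_inequality_of_nonneg (norm_nonneg (σ x)) (norm_nonneg (gradient ψ x))
        hpq.symm
      rw [hσp] at h1
      exact (norm_inner_le_norm _ _).trans h1
    have hinner : ∫ x in Ω, inner ℝ (σ x) (gradient ψ x) ≤
        ∫ x in Ω, (‖G x‖ ^ p / q + ‖gradient ψ x‖ ^ p / p) := by
      refine integral_mono (hbI.mono' (hσm.inner hψ.continuous_gradient.aestronglyMeasurable)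
        (ae_of_all _ hpt)) hbI fun x => (le_abs_self _).trans (hpt x)
    rw [hweak ψ hψ, hψ.setIntegral_eq, integral_add (hGI.div_const q) (hψΩ.div_const p),
      integral_div, integral_div, hT, hψ.setIntegral_norm_gradient_rpow_eq hp0] at hinner
    unfold energy
    rw [one_div_mul_eq_div]
    linarith
  · have h1 := tendsto_integral_norm_rpow hp.le (fun n => (hφ n).memLp_gradient _ _) hG hGlim
    refine le_of_tendsto' (x := atTop) (f := fun n => energy p (φ n)) ?_
      fun n => hbub ⟨_, hφ n, rfl⟩
    rw [hpq1]
    nth_rewrite 2 [← hT]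
    refine (hI.sub (h1.const_mul (1 / p))).congr fun n => ?_
    rw [(hφ n).setIntegral_eq, (hφ n).setIntegral_norm_gradient_rpow_eq hp0]
    rfl

theorem isTorsionFunction_torsionFunction (hD : 1 ≤ D) (hp : 1 < p) (hΩ : Ω ∈ convexDomains D) :
    IsTorsionFunction p Ω (torsionFunction p Ω) := by
  have h := exists_isTorsionFunction hD hp hΩ
  rw [torsionFunction, dif_pos h]
  exact h.choose_spec

/-- The torsional rigidity is `q` times the supremum of the energy over the test functions. -/
theorem isLUB_energies (hD : 1 ≤ D) (hpq : p.HolderConjugate q) (hΩ : Ω ∈ convexDomains D) :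
    IsLUB (energies p Ω) (torsionalRigidity p Ω / q) :=
  isLUB_energies_of_isTorsionFunction hpq hΩ.2.1 (isTorsionFunction_torsionFunction hD hpq.lt hΩ)

section Mollification

open scoped Convolution

/-- Mollification at scale `s` of a compactly supported function with prescribed local Lipschitz
constants. -/
lemma exists_testFunction_of_locally_lipschitz {w g : E D → ℝ} {K : Set (E D)} {δ : ℝ}
    (hΩ : IsOpen Ω) (hw : Continuous w) (hK : IsCompact K) (hKΩ : K ⊆ Ω)
    (hwK : ∀ x ∉ K, w x = 0) (hδ : 0 < δ) (hg : ∀ x, 0 ≤ g x)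
    (hloc : ∀ x, ∀ y ∈ Metric.ball x δ, ∀ z ∈ Metric.ball x δ, |w y - w z| ≤ g x * ‖y - z‖) :
    ∃ φ, IsTestFunction Ω φ ∧ ∫ x, φ x = ∫ x, w x ∧ ∀ x, ‖gradient φ x‖ ≤ g x := by
  have hwsupp : Function.support w ⊆ K := fun x hx => by
    by_contra h; exact hx (hwK x h)
  have hwc : HasCompactSupport w := hK.of_isClosed_subset (isClosed_tsupport w)
    (closure_minimal hwsupp hK.isClosed)
  obtain ⟨r, hr, hrΩ⟩ := hK.exists_cthickening_subset_open hΩ hKΩ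
  set s := min r (δ / 2) with hs
  have hs0 : 0 < s := lt_min hr (by linarith)
  let β : ContDiffBump (0 : E D) := ⟨s / 2, s, by linarith, by linarith⟩
  have hβc : HasCompactSupport (β.normed volume) := β.hasCompactSupport_normed
  have hβcont : Continuous (β.normed volume) := β.continuous_normed
  have hβsupp : Function.support (β.normed volume) = Metric.ball 0 s := β.support_normed_eq
  set φ := (β.normed volume) ⋆[ContinuousLinearMap.lsmul ℝ ℝ, volume] w with hφ
  have hφeq : ∀ x, φ x = ∫ t, β.normed volume t * w (x - t) := fun x => by
    simp [hφ, convolution]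
  have hint : ∀ x, Integrable fun t => β.normed volume t * w (x - t) := fun x =>
    (hβcont.mul (hw.comp (continuous_const.sub continuous_id))).integrable_of_hasCompactSupport
      hβc.mul_right
  have hsm : ContDiff ℝ ∞ φ :=
    hβc.contDiff_convolution_left _ β.contDiff_normed hw.locallyIntegrable
  have hts : tsupport φ ⊆ Ω := by
    refine Set.Subset.trans (closure_minimal (fun x hx => ?_) Metric.isClosed_cthickening) hrΩ
    obtain ⟨t, ht, k, hk, rfl⟩ := Set.mem_add.1 (support_convolution_subset_swap _ hx)
    rw [hβsupp, mem_ball_zero_iff] at hk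
    refine Metric.mem_cthickening_of_dist_le _ t _ _ (hwsupp ht) ?_
    rw [dist_eq_norm, add_sub_cancel_left]
    exact hk.le.trans (min_le_left _ _)
  have hlip : ∀ x, ∀ y ∈ Metric.ball x (δ / 2), |φ y - φ x| ≤ g x * ‖y - x‖ := by
    intro x y hy
    rw [hφeq, hφeq, ← integral_sub (hint y) (hint x)]
    have hle : ∀ t, ‖β.normed volume t * w (y - t) - β.normed volume t * w (x - t)‖ ≤
        β.normed volume t * (g x * ‖y - x‖) := by
      intro t
      rw [← mul_sub, norm_mul, Real.norm_of_nonneg (β.nonneg_normed t), Real.norm_eq_abs]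
      by_cases ht : t ∈ Metric.ball (0 : E D) s
      · refine mul_le_mul_of_nonneg_left ?_ (β.nonneg_normed t)
        rw [mem_ball_zero_iff] at ht
        have hts' : ‖t‖ < δ / 2 := ht.trans_le (min_le_right _ _)
        rw [Metric.mem_ball, dist_eq_norm] at hy
        have h1 := hloc x (y - t) (by
          rw [Metric.mem_ball, dist_eq_norm]
          calc ‖y - t - x‖ = ‖(y - x) - t‖ := by congr 1; abel
            _ ≤ ‖y - x‖ + ‖t‖ := norm_sub_le _ _
            _ < δ := by linarith) (x - t) (by
          rw [Metric.mem_ball, dist_eq_norm]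
          calc ‖x - t - x‖ = ‖t‖ := by rw [← norm_neg]; congr 1; abel
            _ < δ := by linarith)
        simpa using h1
      · have : β.normed volume t = 0 := by
          rw [← hβsupp] at ht; exact Function.notMem_support.1 ht
        simp [this]
    refine (norm_integral_le_of_norm_le ((hβcont.integrable_of_hasCompactSupport
      hβc).mul_const _) (ae_of_all _ hle)).trans (le_of_eq ?_)
    rw [integral_mul_const, β.integral_normed, one_mul]
  refine ⟨φ, ⟨hsm, hβc.convolution _ hwc, hts⟩, ?_, fun x => ?_⟩
  · rw [hφ, integral_convolution _ (hβcont.integrable_of_hasCompactSupport hβc)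
      (hw.integrable_of_hasCompactSupport hwc), β.integral_normed]
    simp
  · rw [norm_gradient]
    refine norm_fderiv_le_of_lip' ℝ (hg x) ?_
    filter_upwards [Metric.ball_mem_nhds x (by linarith : 0 < δ / 2)] with y hy
    exact hlip x y hy

/-- A function vanishing outside `Ω` with local Lipschitz constants given by `g` is an admissible
competitor for the energy. -/
lemma le_of_locally_lipschitz (hp : 1 < p) (hΩ : IsOpen Ω) (hb : Bornology.IsBounded Ω)
    {w g : E D → ℝ} (hw : Continuous w) (hwΩ : ∀ x ∉ Ω, w x = 0)
    (hgc : Continuous g) (hg : ∀ x, 0 ≤ g x)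
    (hloc : ∀ ε > 0, ∃ δ > 0, ∀ x, ∀ y ∈ Metric.ball x δ, ∀ z ∈ Metric.ball x δ,
      |w y - w z| ≤ (g x + ε) * ‖y - z‖) {b : ℝ} (hbub : b ∈ upperBounds (energies p Ω)) :
    (∫ x in Ω, w x) - (1 / p) * ∫ x in Ω, g x ^ p ≤ b := by
  have hp0 : 0 < p := by linarith
  have hfin : volume Ω ≠ ⊤ := hb.measure_lt_top.ne
  have intΩ : ∀ {f : E D → ℝ}, Continuous f → IntegrableOn f Ω := fun hf =>
    (hf.continuousOn.integrableOn_compact hb.isCompact_closure).mono_set subset_closure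
  have cgε : ∀ ε > 0, Continuous fun x => (g x + ε) ^ p := fun ε hε =>
    (hgc.add continuous_const).rpow_const fun _ => Or.inr hp0.le
  have step : ∀ ε > 0, (∫ x in Ω, w x) - ε * volume.real Ω -
      (1 / p) * (∫ x in Ω, (g x + ε) ^ p) ≤ b := by
    intro ε hε
    obtain ⟨δ, hδ, hδloc⟩ := hloc ε hε
    set K := {x | ε ≤ w x} with hK
    have hKΩ : K ⊆ Ω := fun x hx => by
      by_contra h
      have h1 : ε ≤ w x := hx
      rw [hwΩ x h] at h1
      linarith
    have hKc : IsCompact K := Metric.isCompact_of_isClosed_isBounded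
      (isClosed_le continuous_const hw) (hb.subset hKΩ)
    obtain ⟨φ, hφ, hφint, hφg⟩ := exists_testFunction_of_locally_lipschitz
      (w := fun x => max (w x - ε) 0) (g := fun x => g x + ε) hΩ
      ((hw.sub continuous_const).max continuous_const) hKc hKΩ
      (fun x hx => max_eq_right (by
        have : ¬ ε ≤ w x := hx
        linarith)) hδ (fun x => by linarith [hg x])
      (fun x y hy z hz => (abs_max_sub_max_le_abs _ _ _).trans (by
        simpa using hδloc x y hy z hz))
    have h1 : energy p φ ≤ b := hbub ⟨φ, hφ, rfl⟩
    have h2 : (∫ x in Ω, w x) - ε * volume.real Ω ≤ ∫ x, φ x := by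
      rw [hφint]
      have e : ∫ x, max (w x - ε) 0 = ∫ x in Ω, max (w x - ε) 0 :=
        (setIntegral_eq_integral_of_forall_compl_eq_zero fun x hx => by
          rw [hwΩ x hx, zero_sub, max_eq_right (by linarith)]).symm
      rw [e]
      have e2 : ∫ x in Ω, (w x - ε) = (∫ x in Ω, w x) - ε * volume.real Ω := by
        rw [integral_sub (intΩ hw) (integrableOn_const hfin), setIntegral_const, smul_eq_mul,
          mul_comm]
      rw [← e2]
      exact integral_mono (intΩ (hw.sub continuous_const))
        (intΩ ((hw.sub continuous_const).max continuous_const)) fun x => le_max_left _ _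
    have h3 : ∫ x, ‖gradient φ x‖ ^ p ≤ ∫ x in Ω, (g x + ε) ^ p := by
      rw [← hφ.setIntegral_norm_gradient_rpow_eq hp0]
      exact integral_mono (hφ.integrable_norm_gradient_rpow hp0).integrableOn (intΩ (cgε ε hε))
        fun x => Real.rpow_le_rpow (norm_nonneg _) (hφg x) hp0.le
    unfold energy at h1
    have h4 := mul_le_mul_of_nonneg_left h3 (one_div_nonneg.2 hp0.le)
    linarith
  have hu : Tendsto (fun n : ℕ => 1 / ((n : ℝ) + 1)) atTop (𝓝 0) :=
    tendsto_one_div_add_atTop_nhds_zero_nat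
  have hu0 : ∀ n : ℕ, 0 < 1 / ((n : ℝ) + 1) := fun n => Nat.one_div_pos_of_nat
  have hlim : Tendsto (fun n : ℕ => ∫ x in Ω, (g x + 1 / ((n : ℝ) + 1)) ^ p) atTop
      (𝓝 (∫ x in Ω, g x ^ p)) := by
    refine tendsto_integral_of_dominated_convergence (fun x => (g x + 1) ^ p)
      (fun n => (cgε _ (hu0 n)).aestronglyMeasurable) (intΩ (cgε 1 one_pos)) (fun n => ?_) ?_
    · refine ae_of_all _ fun x => ?_
      have h1 : 1 / ((n : ℝ) + 1) ≤ 1 := by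
        rw [div_le_one (by positivity)]; linarith [(n.cast_nonneg : (0 : ℝ) ≤ n)]
      have h2 := hg x
      have h3 := hu0 n
      rw [Real.norm_of_nonneg (by positivity)]
      gcongr
    · refine ae_of_all _ fun x => ?_
      have := (hu.const_add (g x)).rpow_const (p := p) (Or.inr hp0.le)
      simpa using this
  have hl := ((hu.mul_const (volume.real Ω)).const_sub (∫ x in Ω, w x)).sub
    (hlim.const_mul (1 / p))
  rw [zero_mul, sub_zero] at hl
  exact le_of_tendsto' hl fun n => step _ (hu0 n)

end Mollification

section Scaling

open scoped Pointwise

lemma smul_mem_convexDomains (hΩ : Ω ∈ convexDomains D) {t : ℝ} (ht : 0 < t) :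
    t • Ω ∈ convexDomains D :=
  ⟨hΩ.1.smul₀ ht.ne', hΩ.2.1.smul₀ t, hΩ.2.2.1.smul t, hΩ.2.2.2.smul_set⟩

lemma inradius_smul (Ω : Set (E D)) {t : ℝ} (ht : 0 < t) : inradius (t • Ω) = t * inradius Ω := by
  have key : {r : ℝ | 0 < r ∧ ∃ x, Metric.ball x r ⊆ t • Ω} =
      t • {r : ℝ | 0 < r ∧ ∃ x, Metric.ball x r ⊆ Ω} := by
    ext r
    rw [Set.mem_smul_set_iff_inv_smul_mem₀ ht.ne']
    simp only [Set.mem_ofPred_eq, smul_eq_mul]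
    refine and_congr (by simp [ht]) ⟨?_, ?_⟩
    · rintro ⟨x, hx⟩
      refine ⟨t⁻¹ • x, ?_⟩
      have := Set.smul_set_mono (a := t⁻¹) hx
      rwa [inv_smul_smul₀ ht.ne', smul_ball (inv_ne_zero ht.ne'), Real.norm_of_nonneg
        (inv_nonneg.2 ht.le)] at this
    · rintro ⟨x, hx⟩
      refine ⟨t • x, ?_⟩
      have := Set.smul_set_mono (a := t) hx
      rwa [smul_ball ht.ne', Real.norm_of_nonneg ht.le, mul_inv_cancel_left₀ ht.ne'] at this
  rw [inradius, key, Real.sSup_smul_of_nonneg ht.le, smul_eq_mul]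
  rfl

lemma volume_real_smul (Ω : Set (E D)) {t : ℝ} (ht : 0 < t) :
    volume.real (t • Ω) = t ^ D * volume.real Ω := by
  simp [Measure.real, Measure.addHaar_smul, ENNReal.toReal_mul, abs_of_pos ht,
    ENNReal.toReal_ofReal (pow_nonneg ht.le D)]

lemma IsTestFunction.comp_inv_smul (h : IsTestFunction Ω φ) {t : ℝ} (ht : 0 < t) :
    IsTestFunction (t • Ω) fun x => φ (t⁻¹ • x) := by
  have hemb : Topology.IsClosedEmbedding fun x : E D => t⁻¹ • x :=
    (Homeomorph.smulOfNeZero t⁻¹ (inv_ne_zero ht.ne')).isClosedEmbedding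
  refine ⟨h.1.comp (contDiff_const_smul _), h.2.1.comp_isClosedEmbedding hemb, fun x hx => ?_⟩
  rw [Set.mem_smul_set_iff_inv_smul_mem₀ ht.ne']
  exact h.2.2 (tsupport_comp_subset_preimage φ hemb.continuous hx)

lemma IsTestFunction.gradient_comp_inv_smul (h : IsTestFunction Ω φ) (t : ℝ) (x : E D) :
    gradient (fun x => φ (t⁻¹ • x)) x = t⁻¹ • gradient φ (t⁻¹ • x) := by
  have h1 : HasFDerivAt (fun x : E D => t⁻¹ • x) (t⁻¹ • ContinuousLinearMap.id ℝ (E D)) x :=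
    (hasFDerivAt_id x).const_smul t⁻¹
  have h2 : HasFDerivAt (fun x => φ (t⁻¹ • x)) _ x :=
    (h.differentiable (t⁻¹ • x)).hasFDerivAt.comp x h1
  have h3 : fderiv ℝ (fun x => φ (t⁻¹ • x)) x = t⁻¹ • fderiv ℝ φ (t⁻¹ • x) := by
    rw [h2.fderiv]
    ext v
    simp
  simp only [gradient]
  rw [h3, map_smul]

lemma energy_scaling (hpq : p.HolderConjugate q) (h : IsTestFunction Ω φ) {t : ℝ} (ht : 0 < t) :
    energy p (fun x => t ^ q * φ (t⁻¹ • x)) = t ^ q * t ^ D * energy p φ := by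
  have hp0 := hpq.pos
  rw [energy_const_mul (h.comp_inv_smul ht) (by positivity)]
  simp only [h.gradient_comp_inv_smul, norm_smul, Real.norm_of_nonneg (inv_nonneg.2 ht.le),
    Real.mul_rpow (inv_nonneg.2 ht.le) (norm_nonneg _), integral_const_mul]
  rw [Measure.integral_comp_inv_smul_of_nonneg volume φ ht.le,
    Measure.integral_comp_inv_smul_of_nonneg volume (fun x => ‖gradient φ x‖ ^ p) ht.le]
  have h1 : (t ^ q) ^ p * t⁻¹ ^ p = t ^ q := by
    rw [← Real.mul_rpow (by positivity) (by positivity), ← div_eq_mul_inv, ← Real.rpow_sub_one ht.ne',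
      ← Real.rpow_mul ht.le, hpq.symm.sub_one_mul_conj]
  simp only [finrank_euclideanSpace, Fintype.card_fin, smul_eq_mul]
  unfold energy
  linear_combination (-(1 / p) * t ^ D * ∫ x, ‖gradient φ x‖ ^ p) * h1

lemma torsionalRigidity_smul_le (hD : 1 ≤ D) (hpq : p.HolderConjugate q) (hΩ : Ω ∈ convexDomains D)
    {t : ℝ} (ht : 0 < t) :
    t ^ q * t ^ D * torsionalRigidity p Ω ≤ torsionalRigidity p (t • Ω) := by
  have hq0 := hpq.symm.pos
  have h1 := isLUB_energies hD hpq hΩ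
  have h2 := isLUB_energies hD hpq (smul_mem_convexDomains hΩ ht)
  have h3 : torsionalRigidity p Ω / q ≤ torsionalRigidity p (t • Ω) / q / (t ^ q * t ^ D) := by
    refine h1.2 ?_
    rintro _ ⟨φ, hφ, rfl⟩
    rw [le_div_iff₀ (by positivity), mul_comm, ← energy_scaling hpq hφ ht]
    exact h2.1 ⟨_, (hφ.comp_inv_smul ht).const_mul _, rfl⟩
  rw [le_div_iff₀ (by positivity), div_mul_eq_mul_div, div_le_div_iff_of_pos_right hq0] at h3
  linarith

lemma torsionalRigidity_smul (hD : 1 ≤ D) (hpq : p.HolderConjugate q) (hΩ : Ω ∈ convexDomains D)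
    {t : ℝ} (ht : 0 < t) :
    torsionalRigidity p (t • Ω) = t ^ q * t ^ D * torsionalRigidity p Ω := by
  refine le_antisymm ?_ (torsionalRigidity_smul_le hD hpq hΩ ht)
  have h := torsionalRigidity_smul_le hD hpq (smul_mem_convexDomains hΩ ht) (inv_pos.2 ht)
  rw [inv_smul_smul₀ ht.ne', Real.inv_rpow ht.le, inv_pow, ← mul_inv, inv_mul_le_iff₀ (by positivity)] at h
  exact h

end Scaling

section Homogeneous

open scoped Pointwise

/-- The integral of a power of a positively homogeneous function over its unit sublevel set. -/
lemma setIntegral_rpow_of_homogeneous (hD : 1 ≤ D) {j : E D → ℝ} (hj : Continuous j)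
    (hj0 : ∀ x, 0 ≤ j x) (hjs : ∀ s : ℝ, 0 < s → ∀ x, j (s • x) = s * j x)
    (hb : Bornology.IsBounded {x | j x < 1}) (hq : 0 < q) :
    ∫ x in {x | j x < 1}, j x ^ q = D / (D + q) * volume.real {x | j x < 1} := by
  set A := {x | j x < 1} with hA
  set V := volume.real A with hV
  have hAm : MeasurableSet A := (isOpen_lt hj continuous_const).measurableSet
  have hfin : volume A ≠ ⊤ := hb.measure_lt_top.ne
  have hD0 : (0 : ℝ) < D := by exact_mod_cast hD
  have cj : Continuous fun x => j x ^ q := hj.rpow_const fun _ => Or.inr hq.le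
  have ij : IntegrableOn (fun x => j x ^ q) A :=
    (cj.continuousOn.integrableOn_compact hb.isCompact_closure).mono_set subset_closure
  have ic : IntegrableOn (fun _ => (1 : ℝ)) A := integrableOn_const hfin
  have i1 : IntegrableOn (fun x => 1 - j x ^ q) A := ic.sub ij
  have hlevel : ∀ s : ℝ, 0 < s → {x | j x < s} = s • A := by
    intro s hs
    ext x
    rw [Set.mem_smul_set_iff_inv_smul_mem₀ hs.ne']
    simp only [hA, Set.mem_ofPred_eq, hjs _ (inv_pos.2 hs)]
    rw [inv_mul_lt_iff₀ hs, mul_one]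
  have hmeas : ∀ t ∈ Set.Ioi (0 : ℝ), (volume.restrict A).real {x | t < 1 - j x ^ q} =
      (Set.Ioc (0 : ℝ) 1).indicator (fun t => (1 - t) ^ (D / q) * V) t := by
    intro t ht
    have ht0 : 0 < t := ht
    rw [measureReal_restrict_apply (show MeasurableSet {x | t < 1 - j x ^ q} from
      measurableSet_lt measurable_const (measurable_const.sub cj.measurable))]
    rcases lt_or_ge t 1 with h1 | h1
    · rw [Set.indicator_of_mem (show t ∈ Set.Ioc (0 : ℝ) 1 from ⟨ht0, h1.le⟩)]
      have hs : 0 < (1 - t) ^ (1 / q) := Real.rpow_pos_of_pos (by linarith) _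
      have hset : {x | t < 1 - j x ^ q} ∩ A = (1 - t) ^ (1 / q) • A := by
        rw [← hlevel _ hs]
        ext x
        have hiff : j x < (1 - t) ^ (1 / q) ↔ j x ^ q < 1 - t := by
          rw [one_div, Real.lt_rpow_inv_iff_of_pos (hj0 x) (by linarith) hq]
        simp only [hA, Set.mem_inter_iff, Set.mem_ofPred_eq, hiff]
        constructor
        · rintro ⟨h, -⟩; linarith
        · intro h
          refine ⟨by linarith, ?_⟩
          by_contra! hc
          linarith [Real.one_le_rpow hc hq.le]
      rw [hset, volume_real_smul _ hs, ← Real.rpow_natCast, ← Real.rpow_mul (by linarith),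
        one_div_mul_eq_div]
    · have hset : {x | t < 1 - j x ^ q} = ∅ := by
        refine Set.eq_empty_of_forall_notMem fun x hx => ?_
        have h2 : t < 1 - j x ^ q := hx
        linarith [Real.rpow_nonneg (hj0 x) q]
      rw [hset, Set.empty_inter, measureReal_empty]
      rcases h1.eq_or_lt with h1 | h1
      · rw [← h1, Set.indicator_of_mem (show (1 : ℝ) ∈ Set.Ioc (0 : ℝ) 1 from ⟨one_pos, le_rfl⟩), sub_self,
          Real.zero_rpow (by positivity), zero_mul]
      · rw [Set.indicator_of_notMem fun h => not_le.2 h1 h.2]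
  have hlc := i1.integral_eq_integral_meas_lt (ae_restrict_of_forall_mem hAm fun x hx => by
    have : j x ^ q ≤ 1 := Real.rpow_le_one (hj0 x) (le_of_lt hx) hq.le
    simp only [Pi.zero_apply]
    linarith)
  rw [setIntegral_congr_fun measurableSet_Ioi hmeas, setIntegral_indicator measurableSet_Ioc,
    Set.inter_eq_right.2 (fun t ht => ht.1), integral_mul_const,
    ← intervalIntegral.integral_of_le zero_le_one,
    intervalIntegral.integral_comp_sub_left (fun t => t ^ (D / q)) 1,
    integral_rpow (Or.inl (by have : 0 < D / q := by positivity
                              linarith)), integral_sub ic ij,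
    setIntegral_const, smul_eq_mul, mul_one, sub_self, sub_zero, Real.one_rpow,
    Real.zero_rpow (by positivity), sub_zero, ← hV] at hlc
  have e : ∫ x in A, j x ^ q = V - 1 / (D / q + 1) * V := by linarith
  rw [e]
  field_simp
  ring

end Homogeneous

lemma abs_rpow_sub_rpow_le (hq : 1 ≤ q) {a b : ℝ} (ha : 0 ≤ a) (hb : 0 ≤ b) :
    |a ^ q - b ^ q| ≤ q * max a b ^ (q - 1) * |a - b| := by
  wlog h : a ≤ b generalizing a b
  · rw [abs_sub_comm, max_comm, abs_sub_comm a]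
    exact this hb ha (le_of_not_ge h)
  have hmono := Real.rpow_le_rpow ha h (by linarith : 0 ≤ q)
  rw [max_eq_right h, abs_sub_comm, abs_of_nonneg (sub_nonneg.2 hmono), abs_sub_comm,
    abs_of_nonneg (sub_nonneg.2 h)]
  rcases hb.eq_or_lt with hb0 | hb0
  · have : a = 0 := le_antisymm (by linarith) ha
    simp [this, ← hb0]
  · have h1 := one_add_mul_self_le_rpow_one_add (s := a / b - 1)
      (by linarith [div_nonneg ha hb]) hq
    rw [add_sub_cancel, Real.div_rpow ha hb, le_div_iff₀ (by positivity)] at h1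
    have h2 : b ^ q = b ^ (q - 1) * b := by
      rw [← Real.rpow_add_one hb0.ne', sub_add_cancel]
    have h3 : (1 + q * (a / b - 1)) * b ^ q = b ^ q + q * b ^ (q - 1) * (a - b) := by
      rw [h2]; field_simp
    linarith

lemma exists_rpow_le_add (hq : 0 ≤ q) {ε : ℝ} (hε : 0 < ε) :
    ∃ δ > 0, ∀ u ∈ Set.Icc (0 : ℝ) 1, ∀ m ∈ Set.Icc (0 : ℝ) 1, m ≤ u + δ → m ^ q ≤ u ^ q + ε := by
  have huc : UniformContinuousOn (fun u : ℝ => u ^ q) (Set.Icc 0 1) :=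
    isCompact_Icc.uniformContinuousOn_of_continuous
      (Real.continuous_rpow_const hq).continuousOn
  obtain ⟨δ, hδ, h⟩ := Metric.uniformContinuousOn_iff.1 huc ε hε
  refine ⟨δ / 2, by positivity, fun u hu m hm hle => ?_⟩
  rcases le_total m u with hmu | hmu
  · linarith [Real.rpow_le_rpow hm.1 hmu hq]
  · have := h m hm u hu (by
      rw [Real.dist_eq, abs_of_nonneg (sub_nonneg.2 hmu)]; linarith)
    rw [Real.dist_eq] at this
    linarith [le_abs_self (m ^ q - u ^ q)]

/-- The web function `1 - gauge ^ q` bounds the energy from below. -/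
lemma le_of_ball_subset (hD : 1 ≤ D) (hpq : p.HolderConjugate q) (hΩ : Ω ∈ convexDomains D)
    {x₀ : E D} {r : ℝ} (hr : 0 < r) (hball : Metric.ball x₀ r ⊆ Ω) {b : ℝ}
    (hbub : b ∈ upperBounds (energies p Ω)) :
    volume.real Ω * (D * (r / D) ^ q / (D + q)) / q ≤ b := by
  have hp0 := hpq.pos
  have hq0 := hpq.symm.pos
  have hq1 := hpq.symm.lt
  have hD0 : (0 : ℝ) < D := by exact_mod_cast hD
  set Ω₀ : Set (E D) := (fun x => x₀ + x) ⁻¹' Ω with hΩ₀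
  have hball₀ : Metric.ball 0 r ⊆ Ω₀ := fun x hx => hball (by simpa using hx)
  have hopen : IsOpen Ω₀ := hΩ.1.preimage (by fun_prop)
  have hconv : Convex ℝ Ω₀ := hΩ.2.2.1.translate_preimage_right x₀
  have h0 : (0 : E D) ∈ Ω₀ := hball₀ (Metric.mem_ball_self hr)
  set rr : NNReal := ⟨r, hr.le⟩ with hrr
  have hlip := hconv.lipschitzWith_gauge (r := rr) hr hball₀
  have hgc : Continuous (gauge Ω₀) := hlip.continuous
  have hset : {x | gauge Ω₀ x < 1} = Ω₀ :=
    setOfPred_gauge_lt_one_eq_self_of_isOpen hconv h0 hopen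
  have hb₀ : Bornology.IsBounded Ω₀ := by
    have : Ω₀ = (fun x => -x₀ + x) '' Ω := by
      ext x
      simp [hΩ₀]
    rw [this]
    exact (isometry_add_left (-x₀)).lipschitz.isBounded_image hΩ.2.1
  have hmp := measurePreserving_add_left (volume : Measure (E D)) x₀
  have hvol : volume.real Ω₀ = volume.real Ω := by
    simp only [Measure.real]
    rw [hΩ₀, hmp.measure_preimage hΩ.1.measurableSet.nullMeasurableSet]
  have hint : ∀ F : E D → ℝ, ∫ x in Ω, F (x - x₀) = ∫ x in Ω₀, F x := fun F => by
    rw [← hmp.setIntegral_preimage_emb (measurableEmbedding_addLeft x₀)]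
    simp only [add_sub_cancel_left]
    rfl
  set s : E D → ℝ := fun x => min (gauge Ω₀ (x - x₀)) 1 with hs
  have hsc : Continuous s := (hgc.comp (continuous_id.sub continuous_const)).min continuous_const
  have hs01 : ∀ x, s x ∈ Set.Icc (0 : ℝ) 1 := fun x =>
    ⟨le_min (gauge_nonneg _) zero_le_one, min_le_right _ _⟩
  have hslip : ∀ x y, |s x - s y| ≤ ‖x - y‖ / r := by
    intro x y
    refine (abs_min_sub_min_le_max _ _ _ _).trans ?_
    rw [sub_self, abs_zero, max_eq_left (abs_nonneg _)]
    have h1 := hlip.dist_le_mul (x - x₀) (y - x₀)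
    rw [Real.dist_eq, dist_eq_norm, sub_sub_sub_cancel_right] at h1
    rw [div_eq_inv_mul]
    exact h1
  set a : ℝ := (r / D) ^ (q - 1) with ha
  have ha0 : 0 < a := by positivity
  have hpow : ∀ {u : ℝ}, 0 ≤ u → (u ^ (q - 1)) ^ p = u ^ q := fun {u} hu => by
    rw [← Real.rpow_mul hu, hpq.symm.sub_one_mul_conj]
  have hmain := le_of_locally_lipschitz hpq.lt hΩ.1 hΩ.2.1
    (w := fun x => a * r / q * (1 - s x ^ q)) (g := fun x => a * s x ^ (q - 1))
    (continuous_const.mul (continuous_const.sub (hsc.rpow_const fun _ => Or.inr hq0.le)))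
    (fun x hx => by
      have : s x = 1 := by
        refine min_eq_right ?_
        by_contra! hlt
        have h1 : x - x₀ ∈ Ω₀ := by rw [← hset]; exact hlt
        exact hx (by simpa [hΩ₀] using h1)
      simp [this])
    (continuous_const.mul (hsc.rpow_const fun _ => Or.inr (by linarith)))
    (fun x => mul_nonneg ha0.le (Real.rpow_nonneg (hs01 x).1 _))
    (fun ε hε => by
      obtain ⟨δ, hδ, hδε⟩ := exists_rpow_le_add (q := q - 1) (by linarith)
        (show 0 < ε / a by positivity)
      refine ⟨r * δ, by positivity, fun x y hy z hz => ?_⟩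
      have hle : ∀ y ∈ Metric.ball x (r * δ), s y ≤ s x + δ := fun y hy => by
        rw [Metric.mem_ball, dist_eq_norm] at hy
        have h1 := (le_abs_self _).trans (hslip y x)
        have h2 : ‖y - x‖ / r ≤ δ := by rw [div_le_iff₀' hr]; exact hy.le
        linarith
      have hmax := hδε _ (hs01 x) (max (s y) (s z))
        ⟨le_max_of_le_left (hs01 y).1, max_le (hs01 y).2 (hs01 z).2⟩
        (max_le (hle y hy) (hle z hz))
      have h1 := abs_rpow_sub_rpow_le hq1.le (hs01 z).1 (hs01 y).1
      rw [max_comm] at h1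
      have h2 : |a * r / q * (1 - s y ^ q) - a * r / q * (1 - s z ^ q)| =
          a * r / q * |s z ^ q - s y ^ q| := by
        rw [← abs_of_pos (show 0 < a * r / q by positivity), ← abs_mul, abs_of_pos
          (show 0 < a * r / q by positivity)]
        congr 1; ring
      rw [h2]
      have h3 : |s z - s y| ≤ ‖y - z‖ / r := by rw [norm_sub_rev]; exact hslip z y
      have h4 : 0 ≤ max (s y) (s z) ^ (q - 1) :=
        Real.rpow_nonneg (le_max_of_le_left (hs01 y).1) _
      calc a * r / q * |s z ^ q - s y ^ q|
          ≤ a * r / q * (q * max (s y) (s z) ^ (q - 1) * (‖y - z‖ / r)) := by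
            refine mul_le_mul_of_nonneg_left (h1.trans ?_) (by positivity)
            exact mul_le_mul_of_nonneg_left h3 (by positivity)
        _ = a * max (s y) (s z) ^ (q - 1) * ‖y - z‖ := by field_simp
        _ ≤ a * (s x ^ (q - 1) + ε / a) * ‖y - z‖ := by gcongr
        _ = (a * s x ^ (q - 1) + ε) * ‖y - z‖ := by field_simp)
    hbub
  have hj := setIntegral_rpow_of_homogeneous hD hgc (fun x => gauge_nonneg x)
    (fun t ht x => gauge_smul_of_nonneg ht.le x) (by rw [hset]; exact hb₀) hq0
  rw [hset, hvol] at hj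
  have hmin : ∀ x ∈ Ω₀, min (gauge Ω₀ x) 1 = gauge Ω₀ x := fun x hx =>
    min_eq_left (by rw [← hset] at hx; exact le_of_lt hx)
  have hI : ∫ x in Ω₀, min (gauge Ω₀ x) 1 ^ q = D / (D + q) * volume.real Ω := by
    rw [← hj]
    exact setIntegral_congr_fun hopen.measurableSet fun x hx => by simp only [hmin x hx]
  have hIint : IntegrableOn (fun x => min (gauge Ω₀ x) 1 ^ q) Ω₀ :=
    (((hgc.min continuous_const).rpow_const fun _ =>
      Or.inr hq0.le).continuousOn.integrableOn_compact hb₀.isCompact_closure).mono_set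
      subset_closure
  have ic : IntegrableOn (fun _ => (1 : ℝ)) Ω₀ := integrableOn_const hb₀.measure_lt_top.ne
  have e1 : ∫ x in Ω, a * r / q * (1 - s x ^ q) =
      a * r / q * (volume.real Ω - D / (D + q) * volume.real Ω) := by
    simp only [hs]
    rw [hint fun x => a * r / q * (1 - min (gauge Ω₀ x) 1 ^ q), integral_const_mul,
      integral_sub ic hIint, hI, setIntegral_const, hvol,
      smul_eq_mul, mul_one]
  have e2 : ∫ x in Ω, (a * s x ^ (q - 1)) ^ p = (r / D) ^ q * (D / (D + q) * volume.real Ω) := by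
    have : ∀ x, (a * s x ^ (q - 1)) ^ p = (r / D) ^ q * s x ^ q := fun x => by
      rw [Real.mul_rpow ha0.le (Real.rpow_nonneg (hs01 x).1 _), hpow (hs01 x).1,
        ha, hpow (by positivity)]
    simp only [this]
    simp only [hs]
    rw [hint fun x => (r / D) ^ q * min (gauge Ω₀ x) 1 ^ q, integral_const_mul, hI]
  rw [e1, e2] at hmain
  refine le_trans (le_of_eq ?_) hmain
  have har : a * r = D * (r / D) ^ q := by
    have : (r / D) ^ q = a * (r / D) := by
      rw [ha, ← Real.rpow_add_one (by positivity), sub_add_cancel]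
    rw [this]; field_simp
  have hp1 : 1 / p = 1 - q⁻¹ := by rw [hpq.symm.one_sub_inv, one_div]
  rw [har, hp1]
  field_simp
  ring

lemma ball_mem_convexDomains (D : ℕ) : Metric.ball (0 : E D) 1 ∈ convexDomains D :=
  ⟨Metric.isOpen_ball, Metric.isBounded_ball, convex_ball 0 1, ⟨0, by simp⟩⟩

section Ball

lemma IsTestFunction.integral_inner_gradient_self (h : IsTestFunction Ω φ) :
    ∫ x, inner ℝ (gradient φ x) x = -(D * ∫ x, φ x) := by
  set b := EuclideanSpace.basisFun (Fin D) ℝ with hb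
  have hsum : ∀ x, inner ℝ (gradient φ x) x = ∑ i, x i * fderiv ℝ φ x (b i) := fun x => by
    rw [inner_gradient]
    exact (congrArg (fderiv ℝ φ x) (b.sum_repr x)).symm.trans (by simp [hb])
  have hcd : ∀ i, Continuous fun x => fderiv ℝ φ x (b i) := fun i =>
    (h.1.continuous_fderiv (by simp)).clm_apply continuous_const
  have hcc : ∀ i, HasCompactSupport fun x => fderiv ℝ φ x (b i) := fun i =>
    (h.2.1.fderiv ℝ).comp_left (g := fun f : E D →L[ℝ] ℝ => f (b i)) (by simp)
  have hproj : ∀ i, Continuous fun x : E D => x i := fun i => by fun_prop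
  have hint : ∀ i, Integrable fun x : E D => x i * fderiv ℝ φ x (b i) := fun i =>
    ((hproj i).mul (hcd i)).integrable_of_hasCompactSupport (hcc i).mul_left
  have hpd : ∀ i (x : E D), HasFDerivAt (fun x : E D => x i)
      (EuclideanSpace.proj i : E D →L[ℝ] ℝ) x := fun i x =>
    (EuclideanSpace.proj i : E D →L[ℝ] ℝ).hasFDerivAt
  have hder : ∀ i (x : E D), fderiv ℝ (fun x : E D => x i) x (b i) = 1 := fun i x => by
    rw [(hpd i x).fderiv]; simp [hb]
  have hpart : ∀ i, ∫ x : E D, x i * fderiv ℝ φ x (b i) = -∫ x, φ x := fun i => by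
    rw [integral_mul_fderiv_eq_neg_fderiv_mul_of_integrable
      (by simpa only [hder, one_mul] using h.integrable) (hint i)
      (((hproj i).mul h.continuous).integrable_of_hasCompactSupport h.2.1.mul_left)
      (fun x _ => (hpd i x).differentiableAt) (fun x _ => h.differentiable x)]
    simp only [hder, one_mul]
  simp only [hsum]
  rw [integral_finsetSum _ fun i _ => hint i]
  simp [hpart]

lemma energy_two_le_of_ball (hD : 1 ≤ D) (h : IsTestFunction (Metric.ball (0 : E D) 1) φ) :
    energy 2 φ ≤ volume.real (Metric.ball (0 : E D) 1) / (D * (D + 2)) / 2 := by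
  have hD0 : (0 : ℝ) < D := by exact_mod_cast hD
  set B := Metric.ball (0 : E D) 1 with hB
  have hset : {x : E D | ‖x‖ < 1} = B := by ext x; simp [hB]
  have hj := setIntegral_rpow_of_homogeneous hD (j := fun x : E D => ‖x‖) continuous_norm
    (fun x => norm_nonneg x) (fun s hs x => by rw [norm_smul, Real.norm_of_nonneg hs.le])
    (by rw [hset]; exact Metric.isBounded_ball) (q := 2) (by norm_num)
  rw [hset] at hj
  have iI : IntegrableOn (fun x : E D => ‖x‖ ^ (2 : ℝ)) B :=
    ((continuous_norm.rpow_const fun _ =>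
      Or.inr zero_le_two).continuousOn.integrableOn_compact
        Metric.isBounded_ball.isCompact_closure).mono_set subset_closure
  have gI : IntegrableOn (fun x => ‖gradient φ x‖ ^ (2 : ℝ)) B :=
    (h.integrable_norm_gradient_rpow two_pos).integrableOn
  have inI : Integrable fun x => inner ℝ (gradient φ x) x :=
    (h.continuous_gradient.inner continuous_id).integrable_of_hasCompactSupport
      (h.hasCompactSupport_gradient.mono' fun x hx => subset_tsupport _ fun h0 => hx (by simp [h0]))
  have hpt : ∀ x : E D, -(1 / (D : ℝ)) * inner ℝ (gradient φ x) x ≤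
      1 / 2 * ‖gradient φ x‖ ^ (2 : ℝ) + 1 / (2 * D ^ 2) * ‖x‖ ^ (2 : ℝ) := fun x => by
    have h1 := neg_le_of_abs_le (abs_real_inner_le_norm (gradient φ x) x)
    have h2 : 0 ≤ (‖gradient φ x‖ - ‖x‖ / D) ^ 2 := sq_nonneg _
    simp only [Real.rpow_two]
    have h3 : -(1 / (D : ℝ)) * inner ℝ (gradient φ x) x ≤ 1 / D * (‖gradient φ x‖ * ‖x‖) := by
      rw [neg_mul, ← mul_neg]
      gcongr
      linarith
    refine h3.trans ?_
    have h4 : 1 / 2 * ‖gradient φ x‖ ^ 2 + 1 / (2 * (D : ℝ) ^ 2) * ‖x‖ ^ 2 -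
        1 / D * (‖gradient φ x‖ * ‖x‖) = 1 / 2 * (‖gradient φ x‖ - ‖x‖ / D) ^ 2 := by
      field_simp; ring
    linarith
  have hφ : ∫ x, φ x = ∫ x in B, -(1 / (D : ℝ)) * inner ℝ (gradient φ x) x := by
    rw [setIntegral_eq_integral_of_forall_compl_eq_zero fun x hx => by
      simp [h.gradient_eq_zero hx], integral_const_mul, h.integral_inner_gradient_self]
    field_simp
  have hmono := integral_mono (inI.integrableOn.const_mul _)
    ((gI.const_mul (1 / 2)).add (iI.const_mul (1 / (2 * (D : ℝ) ^ 2)))) hpt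
  simp only [Pi.add_apply] at hmono
  rw [← hφ, integral_add (gI.const_mul _) (iI.const_mul _), integral_const_mul,
    integral_const_mul, hj, h.setIntegral_norm_gradient_rpow_eq two_pos] at hmono
  unfold energy
  have e : 1 / (2 * (D : ℝ) ^ 2) * (D / (D + 2) * volume.real B) =
      volume.real B / (D * (D + 2)) / 2 := by field_simp
  linarith

lemma torsionalRigidity_two_ball_le (hD : 1 ≤ D) :
    torsionalRigidity 2 (Metric.ball (0 : E D) 1) ≤
      volume.real (Metric.ball (0 : E D) 1) / (D * (D + 2)) := by
  have h := (isLUB_energies hD Real.HolderConjugate.two_two (ball_mem_convexDomains D)).2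
    (show volume.real (Metric.ball (0 : E D) 1) / (D * (D + 2)) / 2 ∈ _ by
      rintro _ ⟨φ, hφ, rfl⟩
      exact energy_two_le_of_ball hD hφ)
  linarith

end Ball

section Ellipsoid

/-- The quadratic form `|x|^2/4 + 3⟪e, x⟫^2/4`. -/
noncomputable def ellipsoidForm (e x : E D) : ℝ := 1 / 4 * ‖x‖ ^ 2 + 3 / 4 * (inner ℝ e x) ^ 2

/-- Half the gradient of `ellipsoidForm`. -/
noncomputable def ellipsoidGrad (e x : E D) : E D :=
  (1 / 4 : ℝ) • x + (3 / 4 * inner ℝ e x : ℝ) • e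

/-- The ellipsoid with semiaxis `1` in direction `e` and semiaxes `2` orthogonally to `e`. -/
def ellipsoid (e : E D) : Set (E D) := {x | ellipsoidForm e x < 1}

variable {e : E D}

lemma continuous_ellipsoidForm (e : E D) : Continuous (ellipsoidForm e) := by
  unfold ellipsoidForm; fun_prop

lemma continuous_ellipsoidGrad (e : E D) : Continuous (ellipsoidGrad e) := by
  unfold ellipsoidGrad; fun_prop

lemma ellipsoidForm_nonneg (e x : E D) : 0 ≤ ellipsoidForm e x := by
  unfold ellipsoidForm; positivity

lemma ellipsoid_mem_convexDomains (e : E D) : ellipsoid e ∈ convexDomains D := by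
  refine ⟨isOpen_lt (continuous_ellipsoidForm e) continuous_const, ?_, ?_, ⟨0, ?_⟩⟩
  · refine (Metric.isBounded_ball (x := (0 : E D)) (r := 2)).subset fun x hx => ?_
    have h1 : 1 / 4 * ‖x‖ ^ 2 + 3 / 4 * (inner ℝ e x) ^ 2 < 1 := hx
    rw [mem_ball_zero_iff]
    nlinarith [sq_nonneg (inner ℝ e x), norm_nonneg x]
  · have c1 : ConvexOn ℝ Set.univ fun x : E D => ‖x‖ ^ 2 :=
      convexOn_univ_norm.pow (fun x _ => norm_nonneg x) 2
    have c2 : ConvexOn ℝ Set.univ fun x : E D => (inner ℝ e x) ^ 2 :=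
      (even_two.convexOn_pow (𝕜 := ℝ)).comp_linearMap (innerSL ℝ e : E D →L[ℝ] ℝ).toLinearMap
    have c3 := (c1.smul (by norm_num : (0 : ℝ) ≤ 1 / 4)).add
      (c2.smul (by norm_num : (0 : ℝ) ≤ 3 / 4))
    simpa [ellipsoid, ellipsoidForm] using c3.convex_lt 1
  · simp [ellipsoid, ellipsoidForm]

lemma inradius_ellipsoid_le (he : ‖e‖ = 1) : inradius (ellipsoid e) ≤ 1 := by
  refine Real.sSup_le ?_ zero_le_one
  rintro r ⟨hr, x, hx⟩
  by_contra! hlt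
  have hin : ∀ y ∈ ellipsoid e, |inner ℝ e y| < 1 := fun y hy => by
    have h1 : 1 / 4 * ‖y‖ ^ 2 + 3 / 4 * (inner ℝ e y) ^ 2 < 1 := hy
    have h2 : |inner ℝ e y| ≤ ‖y‖ := by simpa [he] using abs_real_inner_le_norm e y
    have h3 : (inner ℝ e y) ^ 2 ≤ ‖y‖ ^ 2 := sq_le_sq' (by linarith [(abs_le.1 h2).1])
      ((abs_le.1 h2).2)
    exact abs_lt_of_sq_lt_sq' (by linarith) zero_le_one |> abs_lt.2
  have hball : ∀ s : ℝ, |s| = 1 → x + s • e ∈ ellipsoid e := fun s hs => hx (by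
    rw [Metric.mem_ball, dist_eq_norm, add_sub_cancel_left, norm_smul, he, Real.norm_eq_abs, hs]
    linarith)
  have h1 := abs_lt.1 (hin _ (hball 1 (by simp)))
  have h2 := abs_lt.1 (hin _ (hball (-1) (by simp)))
  rw [inner_add_smul_self he] at h1 h2
  linarith [h1.2, h2.1]

lemma ellipsoidForm_sub (e y z : E D) :
    ellipsoidForm e y - ellipsoidForm e z = inner ℝ (ellipsoidGrad e (y + z)) (y - z) := by
  simp only [ellipsoidForm, ellipsoidGrad, ← real_inner_self_eq_norm_sq, inner_add_left,
    inner_sub_right, inner_add_right, real_inner_smul_left]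
  rw [real_inner_comm z y]
  ring

lemma norm_ellipsoidGrad_sq (he : ‖e‖ = 1) (x : E D) :
    ‖ellipsoidGrad e x‖ ^ 2 = ellipsoidForm e x - 3 / 16 * (‖x‖ ^ 2 - (inner ℝ e x) ^ 2) := by
  have h1 : inner ℝ e e = (1 : ℝ) := by rw [real_inner_self_eq_norm_sq, he]; norm_num
  rw [ellipsoidForm, ellipsoidGrad, ← real_inner_self_eq_norm_sq]
  simp only [inner_add_left, inner_add_right, real_inner_smul_left, real_inner_smul_right, h1,
    real_inner_comm x e]
  rw [real_inner_self_eq_norm_sq]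
  ring

lemma norm_ellipsoidGrad_le (he : ‖e‖ = 1) (x : E D) : ‖ellipsoidGrad e x‖ ≤ ‖x‖ := by
  have h2 : |inner ℝ e x| ≤ ‖x‖ := by simpa [he] using abs_real_inner_le_norm e x
  refine (norm_add_le _ _).trans ?_
  rw [norm_smul, norm_smul, he, Real.norm_eq_abs, Real.norm_eq_abs, abs_mul,
    abs_of_pos (by norm_num : (0 : ℝ) < 1 / 4), abs_of_pos (by norm_num : (0 : ℝ) < 3 / 4)]
  linarith

lemma setIntegral_ellipsoidForm (hD : 1 ≤ D) (e : E D) :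
    ∫ x in ellipsoid e, ellipsoidForm e x = D / (D + 2) * volume.real (ellipsoid e) := by
  have hset : {x | √(ellipsoidForm e x) < 1} = ellipsoid e := by
    ext x
    simp only [Set.mem_ofPred_eq, ellipsoid]
    rw [Real.sqrt_lt' one_pos, one_pow]
  have hj := setIntegral_rpow_of_homogeneous hD (j := fun x => √(ellipsoidForm e x))
    (continuous_ellipsoidForm e).sqrt (fun x => Real.sqrt_nonneg _) (fun s hs x => by
      have : ellipsoidForm e (s • x) = s ^ 2 * ellipsoidForm e x := by
        simp only [ellipsoidForm, norm_smul, real_inner_smul_right, Real.norm_of_nonneg hs.le]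
        ring
      rw [this, Real.sqrt_mul (sq_nonneg s), Real.sqrt_sq hs.le])
    (by rw [hset]; exact (ellipsoid_mem_convexDomains e).2.1) (q := 2) (by norm_num)
  rw [hset] at hj
  simpa [Real.sq_sqrt (ellipsoidForm_nonneg e _)] using hj

lemma lt_torsionalRigidity_two_ellipsoid (hD : 2 ≤ D) (he : ‖e‖ = 1) :
    volume.real (ellipsoid e) / (D * (D + 2)) < torsionalRigidity 2 (ellipsoid e) := by
  have hD1 : 1 ≤ D := by omega
  have hD0 : (1 : ℝ) ≤ D := by exact_mod_cast hD1
  have hA := ellipsoid_mem_convexDomains e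
  set A := ellipsoid e with hAdef
  have hfin : volume A ≠ ⊤ := hA.2.1.measure_lt_top.ne
  have cN := continuous_ellipsoidForm e
  have cM := continuous_ellipsoidGrad e
  have intA : ∀ {f : E D → ℝ}, Continuous f → IntegrableOn f A := fun hf =>
    (hf.continuousOn.integrableOn_compact hA.2.1.isCompact_closure).mono_set subset_closure
  have hmain := le_of_locally_lipschitz one_lt_two hA.1 hA.2.1
    (w := fun x => 1 / (2 * D) * max (1 - ellipsoidForm e x) 0)
    (g := fun x => 1 / D * ‖ellipsoidGrad e x‖)
    (continuous_const.mul ((continuous_const.sub cN).max continuous_const))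
    (fun x hx => by
      have : 1 ≤ ellipsoidForm e x := not_lt.1 hx
      simp [this]) (continuous_const.mul cM.norm) (fun x => by positivity)
    (fun ε hε => ⟨ε, hε, fun x y hy z hz => by
      rw [Metric.mem_ball, dist_eq_norm] at hy hz
      have h1 : |max (1 - ellipsoidForm e y) 0 - max (1 - ellipsoidForm e z) 0| ≤
          ‖ellipsoidGrad e (y + z)‖ * ‖y - z‖ := by
        refine (abs_max_sub_max_le_abs _ _ _).trans ?_
        rw [sub_sub_sub_cancel_left, ellipsoidForm_sub, add_comm z y, norm_sub_rev]
        exact abs_real_inner_le_norm _ _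
      have h2 : ellipsoidGrad e (y + z) =
          (2 : ℝ) • ellipsoidGrad e x + ellipsoidGrad e ((y - x) + (z - x)) := by
        simp only [ellipsoidGrad, inner_add_right, inner_sub_right]
        module
      have h3 : ‖ellipsoidGrad e (y + z)‖ ≤ 2 * ‖ellipsoidGrad e x‖ + 2 * ε := by
        rw [h2]
        refine (norm_add_le _ _).trans ?_
        have h4 := (norm_ellipsoidGrad_le he ((y - x) + (z - x))).trans (norm_add_le _ _)
        rw [norm_smul, Real.norm_of_nonneg zero_le_two]
        linarith
      rw [← mul_sub, abs_mul, abs_of_pos (by positivity : (0 : ℝ) < 1 / (2 * D))]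
      calc 1 / (2 * (D : ℝ)) * |max (1 - ellipsoidForm e y) 0 - max (1 - ellipsoidForm e z) 0|
          ≤ 1 / (2 * D) * ((2 * ‖ellipsoidGrad e x‖ + 2 * ε) * ‖y - z‖) := by
            refine mul_le_mul_of_nonneg_left (h1.trans ?_) (by positivity)
            gcongr
        _ = (1 / D * ‖ellipsoidGrad e x‖ + ε / D) * ‖y - z‖ := by field_simp
        _ ≤ _ := by
            gcongr
            exact div_le_self hε.le hD0⟩)
    (isLUB_energies hD1 Real.HolderConjugate.two_two hA).1
  have ic : IntegrableOn (fun _ => (1 : ℝ)) A := integrableOn_const hfin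
  have e1 : ∫ x in A, 1 / (2 * (D : ℝ)) * max (1 - ellipsoidForm e x) 0 =
      1 / (2 * D) * (volume.real A - D / (D + 2) * volume.real A) := by
    rw [integral_const_mul, ← setIntegral_ellipsoidForm hD1 e]
    congr 1
    rw [setIntegral_congr_fun hA.1.measurableSet (g := fun x => 1 - ellipsoidForm e x)
      fun x hx => max_eq_left (sub_nonneg.2 (le_of_lt hx)), integral_sub ic (intA cN),
      setIntegral_const, smul_eq_mul, mul_one]
  have cd : Continuous fun x : E D => 3 / 16 * (‖x‖ ^ 2 - (inner ℝ e x) ^ 2) := by fun_prop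
  have hd0 : ∀ x : E D, 0 ≤ 3 / 16 * (‖x‖ ^ 2 - (inner ℝ e x) ^ 2) := fun x => by
    have h2 : |inner ℝ e x| ≤ ‖x‖ := by simpa [he] using abs_real_inner_le_norm e x
    have h3 : (inner ℝ e x) ^ 2 ≤ ‖x‖ ^ 2 := sq_le_sq' (by linarith [(abs_le.1 h2).1])
      ((abs_le.1 h2).2)
    linarith
  have hκ : 0 < ∫ x in A, 3 / 16 * (‖x‖ ^ 2 - (inner ℝ e x) ^ 2) := by
    obtain ⟨f, hf1, hf⟩ : ∃ f : E D, ‖f‖ = 1 ∧ inner ℝ e f = (0 : ℝ) := by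
      have hlt : Module.finrank ℝ (Submodule.span ℝ {e}) < Module.finrank ℝ (E D) := by
        have : Module.finrank ℝ (E D) = D := by simp
        have := finrank_span_singleton (K := ℝ) (v := e) (by rintro rfl; simp at he)
        omega
      have hne : (Submodule.span ℝ {e})ᗮ ≠ ⊥ := fun hbot => by
        rw [Submodule.orthogonal_eq_bot_iff] at hbot
        rw [hbot] at hlt
        simp at hlt
      obtain ⟨v, hv, hv0⟩ := Submodule.exists_mem_ne_zero_of_ne_bot hne
      refine ⟨‖v‖⁻¹ • v, norm_smul_inv_norm (𝕜 := ℝ) hv0, ?_⟩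
      rw [real_inner_smul_right, Submodule.mem_orthogonal_singleton_iff_inner_right.1 hv, mul_zero]
    rw [setIntegral_pos_iff_support_of_nonneg_ae (ae_of_all _ hd0) (intA cd)]
    refine ((cd.isOpen_support).inter hA.1).measure_pos volume ⟨f, ?_, ?_⟩
    · simp [hf1, hf]
    · simp only [hAdef, ellipsoid, ellipsoidForm, Set.mem_ofPred_eq, hf1, hf]
      norm_num
  have e2 : ∫ x in A, (1 / (D : ℝ) * ‖ellipsoidGrad e x‖) ^ (2 : ℝ) =
      1 / D ^ 2 * (D / (D + 2) * volume.real A -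
        ∫ x in A, 3 / 16 * (‖x‖ ^ 2 - (inner ℝ e x) ^ 2)) := by
    rw [← setIntegral_ellipsoidForm hD1 e, ← integral_sub (intA cN) (intA cd),
      ← integral_const_mul]
    congr 1 with x
    rw [Real.rpow_two, mul_pow, norm_ellipsoidGrad_sq he]
    ring
  rw [e1, e2] at hmain
  set κ := ∫ x in A, 3 / 16 * (‖x‖ ^ 2 - (inner ℝ e x) ^ 2)
  have e3 : 1 / (2 * (D : ℝ)) * (volume.real A - D / (D + 2) * volume.real A) -
      1 / 2 * (1 / D ^ 2 * (D / (D + 2) * volume.real A - κ)) =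
      volume.real A / (D * (D + 2)) / 2 + κ / (2 * D ^ 2) := by
    field_simp
    ring
  have h4 : 0 < κ / (2 * (D : ℝ) ^ 2) := by positivity
  linarith

end Ellipsoid

lemma volume_real_pos (hΩ : Ω ∈ convexDomains D) : 0 < volume.real Ω :=
  ENNReal.toReal_pos (hΩ.1.measure_pos volume hΩ.2.2.2).ne' hΩ.2.1.measure_lt_top.ne

/-- Makai's upper bound for the mean of the torsion function. -/
lemma torsionalRigidity_div_volume_le (hD : 1 ≤ D) (hpq : p.HolderConjugate q)
    (hΩ : Ω ∈ convexDomains D) :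
    torsionalRigidity p Ω / volume.real Ω ≤ inradius Ω ^ q / (q + 1) := by
  have hq0 := hpq.symm.pos
  have h := (isLUB_energies hD hpq hΩ).2
    (show inradius Ω ^ q / (q * (q + 1)) * volume.real Ω ∈ _ by
      rintro _ ⟨φ, hφ, rfl⟩
      exact energy_le_makai hD hpq hΩ hφ)
  rw [div_le_iff₀ hq0] at h
  rw [div_le_iff₀ (volume_real_pos hΩ)]
  refine h.trans (le_of_eq ?_)
  field_simp

/-- The mean of the torsion function is at least that of a ball of the same inradius. -/
lemma le_torsionalRigidity_div_volume (hD : 1 ≤ D) (hpq : p.HolderConjugate q)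
    (hΩ : Ω ∈ convexDomains D) :
    D * (inradius Ω / D) ^ q / (D + q) ≤ torsionalRigidity p Ω / volume.real Ω := by
  have hq0 := hpq.symm.pos
  have hD0 : (0 : ℝ) < D := by exact_mod_cast hD
  have hV := volume_real_pos hΩ
  set τ := torsionalRigidity p Ω / volume.real Ω with hτ
  have hlow : ∀ r : ℝ, 0 < r → (∃ x, Metric.ball x r ⊆ Ω) → D * (r / D) ^ q / (D + q) ≤ τ := by
    rintro r hr ⟨x, hx⟩
    have h := le_of_ball_subset hD hpq hΩ hr hx (isLUB_energies hD hpq hΩ).1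
    rw [div_le_div_iff_of_pos_right hq0] at h
    rwa [hτ, le_div_iff₀ hV, mul_comm]
  have hR := inradius_pos hD hΩ
  have hne : {r : ℝ | 0 < r ∧ ∃ x, Metric.ball x r ⊆ Ω}.Nonempty := by
    by_contra hemp
    rw [Set.not_nonempty_iff_eq_empty] at hemp
    rw [inradius, hemp, Real.sSup_empty] at hR
    exact lt_irrefl _ hR
  have hcont : ContinuousOn (fun r : ℝ => D * (r / D) ^ q / (D + q)) Set.univ :=
    (((continuous_id.div_const _).rpow_const fun _ => Or.inr hq0.le).const_mul _
      |>.div_const _).continuousOn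
  have hcl : IsClosed {r : ℝ | D * (r / D) ^ q / (D + q) ≤ τ} :=
    isClosed_le (continuousOn_univ.1 hcont) continuous_const
  exact hcl.closure_subset_iff.2 (fun r hr => hlow r hr.1 hr.2)
    (csSup_mem_closure hne (bddAbove_inradius hD hΩ.2.1))

lemma torsionalRigidity_pos (hD : 1 ≤ D) (hp : 1 < p) (hΩ : Ω ∈ convexDomains D) :
    0 < torsionalRigidity p Ω := by
  have hpq := Real.HolderConjugate.conjExponent hp
  have hq0 := hpq.symm.pos
  have hD0 : (0 : ℝ) < D := by exact_mod_cast hD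
  have hR := inradius_pos hD hΩ
  have h := le_torsionalRigidity_div_volume hD hpq hΩ
  have h1 : 0 < torsionalRigidity p Ω / volume.real Ω := lt_of_lt_of_le (by positivity) h
  exact (div_pos_iff_of_pos_right (volume_real_pos hΩ)).1 h1

lemma normRigidity_eq (hD : 1 ≤ D) (hp : 1 < p) (hΩ : Ω ∈ convexDomains D) :
    normRigidity p Ω = (torsionalRigidity p Ω / volume.real Ω) ^ (1 - p) := by
  have hV := volume_real_pos hΩ
  rw [normRigidity, Real.div_rpow (torsionalRigidity_pos hD hp hΩ).le hV.le,
    show p - 1 = -(1 - p) by ring, Real.rpow_neg hV.le]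
  field_simp

lemma normRigidity_pos (hD : 1 ≤ D) (hp : 1 < p) (hΩ : Ω ∈ convexDomains D) :
    0 < normRigidity p Ω := by
  have hV := volume_real_pos hΩ
  have hT := torsionalRigidity_pos hD hp hΩ
  unfold normRigidity
  positivity

/-- The normalising constant in the definition of `Q`. -/
noncomputable def makaiConst (p : ℝ) : ℝ := ((2 * p - 1) / (p - 1)) ^ (p - 1)

lemma makaiConst_pos (hp : 1 < p) : 0 < makaiConst p := by
  have h1 : 0 < p - 1 := by linarith
  have h2 : 0 < 2 * p - 1 := by linarith
  unfold makaiConst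
  positivity

lemma div_rpow_one_sub (hpq : p.HolderConjugate q) {r : ℝ} (hr : 0 < r) :
    (r ^ q / (q + 1)) ^ (1 - p) = makaiConst p / r ^ p := by
  have hq0 := hpq.symm.pos
  have h1 : q + 1 = (2 * p - 1) / (p - 1) := by
    have := hpq.sub_one_pos
    rw [hpq.conjugate_eq]; field_simp; ring
  have h2 : q * (1 - p) = -p := by linarith [hpq.mul_eq_add]
  have h3 : (0 : ℝ) < (q + 1) ^ (p - 1) := by positivity
  rw [makaiConst, ← h1, Real.div_rpow (by positivity) (by positivity), ← Real.rpow_mul hr.le, h2,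
    show 1 - p = -(p - 1) by ring, Real.rpow_neg hr.le, Real.rpow_neg (by positivity)]
  field_simp

lemma rpow_one_div_rpow {x : ℝ} (hp : 0 < p) (hx : 0 ≤ x) : (x ^ (1 / p)) ^ p = x := by
  rw [← Real.rpow_mul hx, one_div_mul_cancel hp.ne', Real.rpow_one]

lemma Q_rpow (hD : 1 ≤ D) (hp : 1 < p) (hΩ : Ω ∈ convexDomains D) :
    Q p Ω ^ p = normRigidity p Ω * inradius Ω ^ p / makaiConst p := by
  have h1 := normRigidity_pos hD hp hΩ
  have h2 := inradius_pos hD hΩ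
  have h3 := makaiConst_pos hp
  exact rpow_one_div_rpow (by linarith) (by positivity)

lemma Q_nonneg (hD : 1 ≤ D) (hp : 1 < p) (hΩ : Ω ∈ convexDomains D) : 0 ≤ Q p Ω := by
  have h1 := normRigidity_pos hD hp hΩ
  have h2 := inradius_pos hD hΩ
  have h3 := makaiConst_pos hp
  exact Real.rpow_nonneg (show 0 ≤ normRigidity p Ω * inradius Ω ^ p / makaiConst p by positivity) _

lemma one_le_Q (hD : 1 ≤ D) (hp : 1 < p) (hΩ : Ω ∈ convexDomains D) : 1 ≤ Q p Ω := by
  have hpq := Real.HolderConjugate.conjExponent hp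
  have hR := inradius_pos hD hΩ
  have hc := makaiConst_pos hp
  rw [← Real.rpow_le_rpow_iff zero_le_one (Q_nonneg hD hp hΩ) (by linarith : 0 < p),
    Real.one_rpow, Q_rpow hD hp hΩ, le_div_iff₀ hc, one_mul, ← div_le_iff₀ (by positivity),
    ← div_rpow_one_sub hpq hR, normRigidity_eq hD hp hΩ]
  exact Real.rpow_le_rpow_of_nonpos
    (div_pos (torsionalRigidity_pos hD hp hΩ) (volume_real_pos hΩ))
    (torsionalRigidity_div_volume_le hD hpq hΩ) (by linarith)

lemma Q_le (hD : 1 ≤ D) (hp : 1 < p) (hΩ : Ω ∈ convexDomains D) : Q p Ω ≤ D := by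
  have hpq := Real.HolderConjugate.conjExponent hp
  set q := p.conjExponent
  have hq1 := hpq.symm.lt
  have hq0 := hpq.symm.pos
  have hR := inradius_pos hD hΩ
  have hc := makaiConst_pos hp
  have hD0 : (0 : ℝ) < D := by exact_mod_cast hD
  have hD1 : (1 : ℝ) ≤ D := by exact_mod_cast hD
  have hlow : (inradius Ω / D) ^ q / (q + 1) ≤ torsionalRigidity p Ω / volume.real Ω := by
    refine le_trans ?_ (le_torsionalRigidity_div_volume hD hpq hΩ)
    rw [div_le_div_iff₀ (by positivity) (by positivity)]
    have h1 : (D : ℝ) + q ≤ D * (q + 1) := by nlinarith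
    have h2 : 0 ≤ (inradius Ω / D) ^ q := by positivity
    nlinarith [mul_le_mul_of_nonneg_left h1 h2]
  rw [← Real.rpow_le_rpow_iff (Q_nonneg hD hp hΩ) hD0.le (by linarith : 0 < p),
    Q_rpow hD hp hΩ, div_le_iff₀ hc]
  have h3 := Real.rpow_le_rpow_of_nonpos (by positivity) hlow (by linarith : 1 - p ≤ 0)
  rw [div_rpow_one_sub hpq (by positivity), ← normRigidity_eq hD hp hΩ,
    Real.div_rpow hR.le hD0.le] at h3
  have h4 : 0 < inradius Ω ^ p := by positivity
  calc normRigidity p Ω * inradius Ω ^ p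
      ≤ makaiConst p / (inradius Ω ^ p / (D : ℝ) ^ p) * inradius Ω ^ p := by gcongr
    _ = _ := by field_simp

section Scaling

open scoped Pointwise

lemma Q_smul (hD : 1 ≤ D) (hp : 1 < p) (hΩ : Ω ∈ convexDomains D) {t : ℝ} (ht : 0 < t) :
    Q p (t • Ω) = Q p Ω := by
  have hpq := Real.HolderConjugate.conjExponent hp
  set q := p.conjExponent
  have hV := volume_real_pos hΩ
  have hT := torsionalRigidity_pos hD hp hΩ
  have hR := inradius_pos hD hΩ
  have hmean : torsionalRigidity p (t • Ω) / volume.real (t • Ω) =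
      t ^ q * (torsionalRigidity p Ω / volume.real Ω) := by
    rw [torsionalRigidity_smul hD hpq hΩ ht, volume_real_smul Ω ht]
    field_simp
  have h2 : q * (1 - p) = -p := by linarith [hpq.mul_eq_add]
  have hX : normRigidity p (t • Ω) * inradius (t • Ω) ^ p =
      normRigidity p Ω * inradius Ω ^ p := by
    rw [normRigidity_eq hD hp (smul_mem_convexDomains hΩ ht), hmean, normRigidity_eq hD hp hΩ,
      inradius_smul Ω ht, Real.mul_rpow (by positivity) (by positivity),
      Real.mul_rpow ht.le hR.le, ← Real.rpow_mul ht.le, h2, Real.rpow_neg ht.le]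
    have : 0 < t ^ p := by positivity
    field_simp
  rw [Q, Q, hX]

/-- Every convex domain can be rescaled to any inradius without changing `Q`. -/
lemma exists_rescaled (hD : 1 ≤ D) (hp : 1 < p) (hΩ : Ω ∈ convexDomains D) {r : ℝ} (hr : 0 < r) :
    ∃ Ω' ∈ convexDomainsOfInradius D r, Q p Ω' = Q p Ω := by
  have hR := inradius_pos hD hΩ
  have ht : 0 < r / inradius Ω := by positivity
  refine ⟨(r / inradius Ω) • Ω, ⟨smul_mem_convexDomains hΩ ht, ?_⟩, Q_smul hD hp hΩ ht⟩
  rw [inradius_smul Ω ht, div_mul_cancel₀ _ hR.ne']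

end Scaling

lemma normRigidity_eq_Q (hD : 1 ≤ D) (hp : 1 < p) {r : ℝ}
    (hΩ : Ω ∈ convexDomainsOfInradius D r) :
    normRigidity p Ω = makaiConst p * (Q p Ω / r) ^ p := by
  obtain ⟨hΩ, rfl⟩ := hΩ
  have hR := inradius_pos hD hΩ
  have hc := makaiConst_pos hp
  have hRp : 0 < inradius Ω ^ p := by positivity
  rw [Real.div_rpow (Q_nonneg hD hp hΩ) hR.le, Q_rpow hD hp hΩ]
  field_simp

lemma Q_two_lt_Q_two (hD : 2 ≤ D) :
    ∃ A ∈ convexDomains D, ∃ B ∈ convexDomains D, Q 2 A < Q 2 B := by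
  have hD1 : 1 ≤ D := by omega
  have hD0 : (0 : ℝ) < D := by exact_mod_cast hD1
  set e : E D := EuclideanSpace.single ⟨0, hD1⟩ 1 with he
  have hn : ‖e‖ = 1 := by simp [he]
  have hA := ellipsoid_mem_convexDomains e
  have hB := ball_mem_convexDomains D
  refine ⟨_, hA, _, hB, ?_⟩
  have hRA := inradius_pos hD1 hA
  have hRA1 := inradius_ellipsoid_le hn
  have hRB : 1 ≤ inradius (Metric.ball (0 : E D) 1) := le_inradius hD1 hB.2.1 one_pos subset_rfl
  have hτA := lt_torsionalRigidity_two_ellipsoid hD hn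
  have hτB := torsionalRigidity_two_ball_le hD1
  have hTB := torsionalRigidity_pos hD1 one_lt_two hB
  have hVA := volume_real_pos hA
  have hVB := volume_real_pos hB
  have hc := makaiConst_pos one_lt_two
  set m : ℝ := 1 / (D * (D + 2)) with hm
  have hm0 : 0 < m := by positivity
  have hA1 : m < torsionalRigidity 2 (ellipsoid e) / volume.real (ellipsoid e) := by
    rw [lt_div_iff₀ hVA, hm, one_div_mul_eq_div]; exact hτA
  have hB1 : torsionalRigidity 2 (Metric.ball (0 : E D) 1) /
      volume.real (Metric.ball (0 : E D) 1) ≤ m := by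
    rw [div_le_iff₀ hVB, hm, one_div_mul_eq_div]; exact hτB
  have hNA : normRigidity 2 (ellipsoid e) < m ^ (1 - 2 : ℝ) := by
    rw [normRigidity_eq hD1 one_lt_two hA]
    exact Real.rpow_lt_rpow_of_neg hm0 hA1 (by norm_num)
  have hNB : m ^ (1 - 2 : ℝ) ≤ normRigidity 2 (Metric.ball (0 : E D) 1) := by
    rw [normRigidity_eq hD1 one_lt_two hB]
    exact Real.rpow_le_rpow_of_nonpos (div_pos hTB hVB) hB1 (by norm_num)
  have hNA0 := normRigidity_pos hD1 one_lt_two hA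
  rw [← Real.rpow_lt_rpow_iff (Q_nonneg hD1 one_lt_two hA) (Q_nonneg hD1 one_lt_two hB) two_pos,
    Q_rpow hD1 one_lt_two hA, Q_rpow hD1 one_lt_two hB]
  refine div_lt_div_of_pos_right ?_ hc
  have h1 : inradius (ellipsoid e) ^ (2 : ℝ) ≤ 1 := Real.rpow_le_one hRA.le hRA1 zero_le_two
  have h2 : 1 ≤ inradius (Metric.ball (0 : E D) 1) ^ (2 : ℝ) := Real.one_le_rpow hRB zero_le_two
  calc normRigidity 2 (ellipsoid e) * inradius (ellipsoid e) ^ (2 : ℝ)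
      ≤ normRigidity 2 (ellipsoid e) := mul_le_of_le_one_right hNA0.le h1
    _ < m ^ (1 - 2 : ℝ) := hNA
    _ ≤ normRigidity 2 (Metric.ball (0 : E D) 1) := hNB
    _ ≤ _ := le_mul_of_one_le_right (hNA0.trans (hNA.trans_le hNB)).le h2

instance nonempty_convexDomains : Nonempty (convexDomains D) :=
  ⟨⟨_, ball_mem_convexDomains D⟩⟩

lemma bddBelow_range_Q (hD : 1 ≤ D) (hp : 1 < p) :
    BddBelow (Set.range fun Ω : convexDomains D => Q p (Ω : Set (E D))) :=
  ⟨1, by rintro _ ⟨Ω, rfl⟩; exact one_le_Q hD hp Ω.2⟩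

lemma bddAbove_range_Q (hD : 1 ≤ D) (hp : 1 < p) :
    BddAbove (Set.range fun Ω : convexDomains D => Q p (Ω : Set (E D))) :=
  ⟨D, by rintro _ ⟨Ω, rfl⟩; exact Q_le hD hp Ω.2⟩

lemma alpha_le_Q (hD : 1 ≤ D) (hp : 1 < p) (hΩ : Ω ∈ convexDomains D) : alpha D p ≤ Q p Ω :=
  ciInf_le (bddBelow_range_Q hD hp) ⟨Ω, hΩ⟩

lemma Q_le_beta (hD : 1 ≤ D) (hp : 1 < p) (hΩ : Ω ∈ convexDomains D) : Q p Ω ≤ beta D p :=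
  le_ciSup (bddAbove_range_Q hD hp) ⟨Ω, hΩ⟩

lemma one_le_alpha (hD : 1 ≤ D) (hp : 1 < p) : 1 ≤ alpha D p :=
  le_ciInf fun Ω => one_le_Q hD hp Ω.2

lemma beta_le (hD : 1 ≤ D) (hp : 1 < p) : beta D p ≤ D :=
  ciSup_le fun Ω => Q_le hD hp Ω.2

lemma beta_pos (hD : 1 ≤ D) (hp : 1 < p) : 0 < beta D p :=
  lt_of_lt_of_le (zero_lt_one.trans_le (one_le_Q hD hp (ball_mem_convexDomains D)))
    (Q_le_beta hD hp (ball_mem_convexDomains D))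

lemma one_div_le_gammaDp (hD : 1 ≤ D) (hp : 1 < p) : 1 / (D : ℝ) ≤ gammaDp D p :=
  div_le_div₀ (zero_le_one.trans (one_le_alpha hD hp)) (one_le_alpha hD hp) (beta_pos hD hp)
    (beta_le hD hp)

lemma gammaD_le_gammaDp (hD : 1 ≤ D) (hp : 1 < p) : gammaD D ≤ gammaDp D p :=
  ciInf_le (f := fun p : Set.Ioi (1 : ℝ) => gammaDp D (p : ℝ))
    ⟨1 / (D : ℝ), by rintro _ ⟨r, rfl⟩; exact one_div_le_gammaDp hD r.2⟩ ⟨p, hp⟩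

instance nonempty_Ioi_one : Nonempty (Set.Ioi (1 : ℝ)) := ⟨⟨2, Set.mem_Ioi.2 one_lt_two⟩⟩

lemma gammaD_mem_Ico (hD : 2 ≤ D) : gammaD D ∈ Set.Ico (1 / (D : ℝ)) 1 := by
  have hD1 : 1 ≤ D := by omega
  refine ⟨le_ciInf fun p => one_div_le_gammaDp hD1 p.2,
    (gammaD_le_gammaDp hD1 one_lt_two).trans_lt ?_⟩
  obtain ⟨A, hA, B, hB, hlt⟩ := Q_two_lt_Q_two hD
  rw [gammaDp, div_lt_one (beta_pos hD1 one_lt_two)]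
  exact ((alpha_le_Q hD1 one_lt_two hA).trans_lt hlt).trans_le (Q_le_beta hD1 one_lt_two hB)

lemma exists_normRigidity_lt (hD : 1 ≤ D) {a b : ℝ} (ha : 0 < a) (hb : 0 < b)
    (h : gammaD D * b < a) :
    ∃ p : ℝ, 1 < p ∧ ∃ Ωa ∈ convexDomainsOfInradius D a, ∃ Ωb ∈ convexDomainsOfInradius D b,
      normRigidity p Ωa < normRigidity p Ωb := by
  rw [← lt_div_iff₀ hb] at h
  obtain ⟨⟨p, hp⟩, hlt⟩ := exists_lt_of_ciInf_lt h
  have hp1 : 1 < p := hp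
  have hβ := beta_pos hD hp1
  have h1 : alpha D p < a / b * beta D p := (div_lt_iff₀ hβ).1 hlt
  obtain ⟨⟨A, hA⟩, hAlt⟩ := exists_lt_of_ciInf_lt h1
  have h2 : Q p A / (a / b) < beta D p := by
    rw [div_lt_iff₀' (by positivity)]; exact hAlt
  obtain ⟨⟨B, hB⟩, hBlt⟩ := exists_lt_of_lt_ciSup h2
  obtain ⟨A', hA', hQA⟩ := exists_rescaled hD hp1 hA ha
  obtain ⟨B', hB', hQB⟩ := exists_rescaled hD hp1 hB hb
  refine ⟨p, hp1, A', hA', B', hB', ?_⟩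
  have hA0 := Q_nonneg hD hp1 hA
  have hBlt' : Q p A / (a / b) < Q p B := hBlt
  rw [normRigidity_eq_Q hD hp1 hA', normRigidity_eq_Q hD hp1 hB', hQA, hQB]
  refine mul_lt_mul_of_pos_left (Real.rpow_lt_rpow (by positivity) ?_ (by linarith))
    (makaiConst_pos hp1)
  rw [lt_div_iff₀ hb]
  calc Q p A / a * b = Q p A / (a / b) := by field_simp
    _ < Q p B := hBlt'

lemma gammaD_mul_Q_le (hD : 1 ≤ D) (hp : 1 < p) {A B : Set (E D)} (hA : A ∈ convexDomains D)
    (hB : B ∈ convexDomains D) : gammaD D * Q p B ≤ Q p A := by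
  have h0 : 0 ≤ gammaDp D p := le_trans (by positivity) (one_div_le_gammaDp hD hp)
  calc gammaD D * Q p B ≤ gammaDp D p * Q p B :=
        mul_le_mul_of_nonneg_right (gammaD_le_gammaDp hD hp) (Q_nonneg hD hp hB)
    _ ≤ gammaDp D p * beta D p := mul_le_mul_of_nonneg_left (Q_le_beta hD hp hB) h0
    _ = alpha D p := div_mul_cancel₀ _ (beta_pos hD hp).ne'
    _ ≤ Q p A := alpha_le_Q hD hp hA

lemma normRigidity_le (hD : 1 ≤ D) (hp : 1 < p) {a b : ℝ} (ha : 0 < a) (hb : 0 < b)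
    (h : a ≤ gammaD D * b) {A B : Set (E D)} (hA : A ∈ convexDomainsOfInradius D a)
    (hB : B ∈ convexDomainsOfInradius D b) : normRigidity p B ≤ normRigidity p A := by
  have hB0 := Q_nonneg hD hp hB.1
  rw [normRigidity_eq_Q hD hp hA, normRigidity_eq_Q hD hp hB]
  refine mul_le_mul_of_nonneg_left (Real.rpow_le_rpow (by positivity) ?_ (by linarith))
    (makaiConst_pos hp).le
  rw [div_le_div_iff₀ hb ha]
  calc Q p B * a ≤ Q p B * (gammaD D * b) := mul_le_mul_of_nonneg_left h hB0
    _ = gammaD D * Q p B * b := by ring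
    _ ≤ Q p A * b := mul_le_mul_of_nonneg_right (gammaD_mul_Q_le hD hp hA.1 hB.1) hb.le

lemma normRigidity_lt (hD : 1 ≤ D) (hp : 1 < p) {a b : ℝ} (ha : 0 < a) (hb : 0 < b)
    (h : a < gammaD D * b) {A B : Set (E D)} (hA : A ∈ convexDomainsOfInradius D a)
    (hB : B ∈ convexDomainsOfInradius D b) : normRigidity p B < normRigidity p A := by
  have hB0 : 0 < Q p B := zero_lt_one.trans_le (one_le_Q hD hp hB.1)
  rw [normRigidity_eq_Q hD hp hA, normRigidity_eq_Q hD hp hB]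
  refine mul_lt_mul_of_pos_left (Real.rpow_lt_rpow (by positivity) ?_ (by linarith))
    (makaiConst_pos hp)
  rw [div_lt_div_iff₀ hb ha]
  calc Q p B * a < Q p B * (gammaD D * b) := mul_lt_mul_of_pos_left h hB0
    _ = gammaD D * Q p B * b := by ring
    _ ≤ Q p A * b := mul_le_mul_of_nonneg_right (gammaD_mul_Q_le hD hp hA.1 hB.1) hb.le

end PTorsion

theorem mainTheorem2 (D : ℕ) (hD : 2 ≤ D) :
    PTorsion.gammaD D ∈ Set.Ico (1 / (D : ℝ)) 1 ∧
    ∀ a b : ℝ, 0 < a → a < b →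
      (PTorsion.gammaD D * b < a →
        ∃ p : ℝ, 1 < p ∧
          ∃ Ωa ∈ PTorsion.convexDomainsOfInradius D a,
          ∃ Ωb ∈ PTorsion.convexDomainsOfInradius D b,
            PTorsion.normRigidity p Ωa < PTorsion.normRigidity p Ωb) ∧
      (a ≤ PTorsion.gammaD D * b →
        ∀ Ωa ∈ PTorsion.convexDomainsOfInradius D a,
        ∀ Ωb ∈ PTorsion.convexDomainsOfInradius D b,
        ∀ p : ℝ, 1 < p → PTorsion.normRigidity p Ωb ≤ PTorsion.normRigidity p Ωa) ∧
      (a < PTorsion.gammaD D * b →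
        ∀ Ωa ∈ PTorsion.convexDomainsOfInradius D a,
        ∀ Ωb ∈ PTorsion.convexDomainsOfInradius D b,
        ∀ p : ℝ, 1 < p → PTorsion.normRigidity p Ωb < PTorsion.normRigidity p Ωa) := by
  have hD1 : 1 ≤ D := by omega
  refine ⟨PTorsion.gammaD_mem_Ico hD, fun a b ha hab => ?_⟩
  have hb : 0 < b := ha.trans hab
  exact ⟨PTorsion.exists_normRigidity_lt hD1 ha hb,
    fun h Ωa hΩa Ωb hΩb p hp => PTorsion.normRigidity_le hD1 hp ha hb h hΩa hΩb,
    fun h Ωa hΩa Ωb hΩb p hp => PTorsion.normRigidity_lt hD1 hp ha hb h hΩa hΩb⟩
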